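/- Notation. Fix an integer $d\ge 1$, let $\mathbb R_+=[0,+\infty)$, $\overline{\mathbb R}_+=[0,+\infty]$, and let $\mathcal P(S)$ be the set of Borel probability measures on a topological space $S$. The mean field game. Let $\Omega\subset\mathbb R^d$, let $\Gamma=C(\mathbb R_+;\overline\Omega)$ carry the topology of uniform convergence on compact time intervals, and let $e_0(\gamma)=\gamma(0)$. "Absolutely continuous" means absolutely continuous on every bounded time interval. Let $\Xi\subset\overline\Omega$, $\ell:\mathbb R_+\times\overline\Omega\times\mathbb R^d\to\mathbb R_+$, $h:\mathbb R_+\times\overline\Omega\times\overline\Omega\times\mathbb R^d\times\mathbb R^d\to\mathbb R_+$ and $\Psi:\mathbb R_+\to\mathbb R_+$, with $\Psi(+\infty)=+\infty$. The exit time is $\tau(\gamma)=\inf\{t\in\mathbb R_+ : \gamma(t)\in\Xi\}$, with $\inf\emptyset=+\infty$. For $Q\in\mathcal P(\Gamma)$ put $$F_1(\gamma,Q)=\int_0^{+\infty}\ell(t,\gamma,\dot\gamma)\,dt+\Psi(\tau(\gamma))+\int_\Gamma\int_0^{\tau(\gamma)\wedge\tau(\tilde\gamma)}h(t,\gamma,\tilde\gamma,\dot\gamma,\dot{\tilde\gamma})\,dt\,dQ(\tilde\gamma),$$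 and $F_1(\gamma,Q)=+\infty$ if $\gamma$ is not absolutely continuous, if $Q$ gives positive measure to the set of curves that are not absolutely continuous, or if $\tilde\gamma\mapsto\int_0^{\tau(\gamma)\wedge\tau(\tilde\gamma)}h(t,\gamma,\tilde\gamma,\dot\gamma,\dot{\tilde\gamma})\,dt$ is not $Q$-integrable. Given $m_0\in\mathcal P(\overline\Omega)$, $Q\in\mathcal P(\Gamma)$ is an equilibrium of the mean field game with initial condition $m_0$ if $(e_0)_\#Q=m_0$, $\int_\Gamma F_1(\gamma,Q)\,dQ(\gamma)<+\infty$, and $F_1(\gamma,Q)=\inf_{\omega\in\Gamma,\ \omega(0)=\gamma(0)}F_1(\omega,Q)$ for $Q$-a.e. $\gamma$. Hypotheses. (H1) $\Omega$ is nonempty, open and bounded. (H2) $\Xi\subset\overline\Omega$ is nonempty and closed. (H3) $\ell(\cdot,x,p)$ is Lebesgue measurable for all $(x,p)$; for a.e. $t$, $\ell(t,\cdot,\cdot)$ is continuous and $\ell(t,x,\cdot)$ is convex for all $x$; and there are $\alpha>0$, $\theta>1$ with $\ell(t,x,p)\ge\alpha|p|^\theta$ for all $(t,x,p)$. (H4)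 $h(\cdot,x,\tilde x,p,\tilde p)$ is Lebesgue measurable for all $(x,\tilde x,p,\tilde p)$; for a.e. $t$, $h(t,\cdot)$ is continuous and $(p,\tilde p)\mapsto h(t,x,\tilde x,p,\tilde p)$ is convex for all $(x,\tilde x)$; $h(t,x,\tilde x,p,\tilde p)=h(t,\tilde x,x,\tilde p,p)$ always; and there are $C>0$ and $\beta\in(0,\theta]$, with $\theta$ as in (H3), such that $h(t,x,\tilde x,p,\tilde p)\le C(|p|^\beta+|\tilde p|^\beta)$ always. (H5) $\Psi$ is lower semicontinuous and nondecreasing, and there are $a,b>0$ with $\Psi(t)\ge at-b$ for all $t\in\mathbb R_+$. (H6) There is $\kappa>0$ such that every $x_0\in\overline\Omega$ is the initial point of an absolutely continuous $\gamma\in\Gamma$ with $\int_0^{+\infty}\ell(t,\gamma,\dot\gamma)\,dt+\Psi(\tau(\gamma))\le\kappa$. The non-atomic game. For $\pi:X\to Y$, $L:X\to\overline{\mathbb R}_+$, $H:X\times X\to\overline{\mathbb R}_+$ and $m_0\in\mathcal P(Y)$, put $F_2(x,Q)=L(x)+\int_XH(x,\tilde x)\,dQ(\tilde x)$ and $J(x,\tilde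 x)=L(x)+L(\tilde x)+H(x,\tilde x)$. A measure $Q\in\mathcal P(X)$ is an equilibrium of $\mathrm{NAG}(X,Y,\pi,L,H,m_0)$ if $\pi_\#Q=m_0$, $\int_XF_2(x,Q)\,dQ(x)<+\infty$, and $Q$-a.e. $x$ minimizes $F_2(\cdot,Q)$ over $\{x'\in X:\pi(x')=\pi(x)\}$. Consider the assumptions: (A1) $X$ and $Y$ are Polish; (A2) $\pi$ is continuous; (A3) $L$ is lower semicontinuous and $H$ is Borel measurable; (A4) $H$ is symmetric; (A5) $J$ is lower semicontinuous on $X\times X$; (A6) there is $\kappa>0$ such that each $y\in Y$ equals $\pi(x)$ for some $x$ with $L(x)\le\kappa$; (A7) $\{L\le\kappa\}$ is compact for every $\kappa>0$; (A8) there is $C>0$ with $H(x,\tilde x)\le C(L(x)+L(\tilde x)+1)$ for all $x,\tilde x$. The game associated with the mean field game has $X=\Gamma$, $Y=\overline\Omega$, $\pi=e_0$; $L(\gamma)=\int_0^{+\infty}\ell(t,\gamma,\dot\gamma)\,dt+\Psi(\tau(\gamma))$ if $\gamma$ is absolutely continuous and $L(\gamma)=+\infty$ otherwise; $H(\gamma,\tilde\gamma)=\int_0^{\tau(\gamma)\wedge\tau(\tilde\gamma)}h(t,\gamma,\tilde\gamma,\dot\gamma,\dot{\tilde\gamma})\,dt$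 if $L(\gamma)<+\infty$ and $L(\tilde\gamma)<+\infty$, and $H(\gamma,\tilde\gamma)=+\infty$ otherwise. Proposition. Assume (H1)–(H6) and let $m_0\in\mathcal P(\overline\Omega)$. Then the associated game $\mathrm{NAG}(\Gamma,\overline\Omega,e_0,L,H,m_0)$ satisfies (A1)–(A8), the exit time $\tau:\Gamma\to\overline{\mathbb R}_+$ is lower semicontinuous, and every $Q\in\mathcal P(\Gamma)$ is an equilibrium of the mean field game with initial condition $m_0$ if and only if it is an equilibrium of $\mathrm{NAG}(\Gamma,\overline\Omega,e_0,L,H,m_0)$. -/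

import Mathlib

open MeasureTheory Set
open scoped NNReal ENNReal

noncomputable section

/-! ### Non-atomic games with pairwise interactions -/

/-- The data `(X, Y, π, L, H, m₀)` of a non-atomic game with pairwise interactions. Regularity
(in particular Borel measurability) of `π`, `L` and `H` is part of `NAG.Assumptions`. -/
structure NAG (X Y : Type*) [MeasurableSpace Y] where
  π : X → Y
  L : X → ℝ≥0∞
  H : X → X → ℝ≥0∞
  m₀ : ProbabilityMeasure Y

namespace NAG

variable {X Y : Type*} [MeasurableSpace X] [MeasurableSpace Y]

/-- The cost `F(x, Q) = L(x) + ∫ H(x, x̃) dQ(x̃)`. -/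
def F (G : NAG X Y) (x : X) (Q : ProbabilityMeasure X) : ℝ≥0∞ :=
  G.L x + ∫⁻ x', G.H x x' ∂(Q : Measure X)

/-- `J(x, x̃) = L(x) + L(x̃) + H(x, x̃)`. -/
def J (G : NAG X Y) (x x' : X) : ℝ≥0∞ := G.L x + G.L x' + G.H x x'

/-- `x` solves the problem of minimizing `F(·, Q)` under the constraint `π = y`. -/
def Solves (G : NAG X Y) (x : X) (y : Y) (Q : ProbabilityMeasure X) : Prop :=
  G.π x = y ∧ ∀ x', G.π x' = y → G.F x Q ≤ G.F x' Q

/-- Equilibria of the non-atomic game. -/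
structure IsEquilibrium (G : NAG X Y) (Q : ProbabilityMeasure X) : Prop where
  marginal : (Q : Measure X).map G.π = (G.m₀ : Measure Y)
  finite_cost : ∫⁻ x, G.F x Q ∂(Q : Measure X) < ⊤
  optimal : ∀ᵐ x ∂(Q : Measure X), G.Solves x (G.π x) Q

/-- The assumptions (A1)--(A8) on a non-atomic game. -/
structure Assumptions [TopologicalSpace X] [TopologicalSpace Y] (G : NAG X Y) : Prop where
  polish : PolishSpace X ∧ PolishSpace Y
  continuous_π : Continuous G.π
  lsc_L_measurable_H : LowerSemicontinuous G.L ∧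
    Measurable[borel (X × X), borel ℝ≥0∞] (fun z : X × X => G.H z.1 z.2)
  symm_H : ∀ x x', G.H x x' = G.H x' x
  lsc_J : LowerSemicontinuous (fun z : X × X => G.J z.1 z.2)
  domain : ∃ κ : ℝ≥0, 0 < κ ∧ ∀ y, ∃ x, G.π x = y ∧ G.L x ≤ κ
  compact : ∀ κ : ℝ≥0, 0 < κ → IsCompact {x | G.L x ≤ κ}
  H_le : ∃ C : ℝ≥0, 0 < C ∧ ∀ x x', G.H x x' ≤ C * (G.L x + G.L x' + 1)

end NAG

/-! ### The crowd-motion mean field game with free final time -/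

/-- Lebesgue measure on the half-line `[0, ∞)`. -/
def halfLine : Measure ℝ≥0 := (volume : Measure ℝ).comap (fun t : ℝ≥0 => (t : ℝ))

/-- The space of continuous curves from `[0, ∞)` to the closure of `Ω`. The topology of `C(·, ·)`
is the compact-open one, i.e. uniform convergence on compact time intervals. -/
abbrev Traj {d : ℕ} (Ω : Set (EuclideanSpace ℝ (Fin d))) : Type := C(ℝ≥0, closure Ω)

namespace Traj

variable {d : ℕ} {Ω : Set (EuclideanSpace ℝ (Fin d))}

instance : MeasurableSpace (Traj Ω) := borel (Traj Ω)

instance : BorelSpace (Traj Ω) := ⟨rfl⟩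

/-- The curve as a function of real time with values in `ℝᵈ`, constant for negative times. -/
def curve (γ : Traj Ω) (s : ℝ) : EuclideanSpace ℝ (Fin d) := (γ s.toNNReal : EuclideanSpace ℝ (Fin d))

/-- Absolute continuity on every bounded time interval. -/
def IsAC (γ : Traj Ω) : Prop :=
  ∀ T : ℝ, 0 ≤ T → AbsolutelyContinuousOnInterval (curve γ) 0 T

/-- The velocity of a curve (only meaningful at almost every time, for `IsAC` curves). -/
def vel (γ : Traj Ω) (t : ℝ≥0) : EuclideanSpace ℝ (Fin d) := deriv (curve γ) (t : ℝ)

/-- The evaluation map `e₀`. -/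
def e₀ (γ : Traj Ω) : closure Ω := γ 0

/-- The first time at which the curve reaches `Ξ`, and `⊤` if it never does. -/
def exitTime (Ξ : Set (EuclideanSpace ℝ (Fin d))) (γ : Traj Ω) : ℝ≥0∞ :=
  ⨅ (t : ℝ≥0) (_ : (γ t : EuclideanSpace ℝ (Fin d)) ∈ Ξ), (t : ℝ≥0∞)

end Traj

/-- The data of the mean field game in dimension `d`: domain `Ω`, target set `Ξ`, running
cost `ℓ`, interaction cost `h` and final-time cost `Ψ`. -/
structure CrowdMFG (d : ℕ) where
  Ω : Set (EuclideanSpace ℝ (Fin d))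
  Ξ : Set (EuclideanSpace ℝ (Fin d))
  ℓ : ℝ≥0 → closure Ω → EuclideanSpace ℝ (Fin d) → ℝ≥0
  h : ℝ≥0 → closure Ω → closure Ω → EuclideanSpace ℝ (Fin d) → EuclideanSpace ℝ (Fin d) → ℝ≥0
  Ψ : ℝ≥0 → ℝ≥0

namespace CrowdMFG

open Traj

variable {d : ℕ} (M : CrowdMFG d)

/-- The exit time `τ`. -/
def τ (γ : Traj M.Ω) : ℝ≥0∞ := exitTime M.Ξ γ

/-- The extension of `Ψ` to `[0, ∞]` by `Ψ(∞) = ∞`. -/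
def Ψext (s : ℝ≥0∞) : ℝ≥0∞ := if s = ⊤ then ⊤ else (M.Ψ s.toNNReal : ℝ≥0∞)

/-- `∫₀^∞ ℓ(t, γ(t), γ'(t)) dt + Ψ(τ(γ))`. -/
def individualCost (γ : Traj M.Ω) : ℝ≥0∞ :=
  ∫⁻ t, (M.ℓ t (γ t) (vel γ t) : ℝ≥0∞) ∂halfLine + M.Ψext (M.τ γ)

/-- `∫₀^{τ(γ) ∧ τ(γ̃)} h(t, γ(t), γ̃(t), γ'(t), γ̃'(t)) dt`. -/
def pairCost (γ γ' : Traj M.Ω) : ℝ≥0∞ :=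
  ∫⁻ t in {t : ℝ≥0 | (t : ℝ≥0∞) < min (M.τ γ) (M.τ γ')},
    (M.h t (γ t) (γ' t) (vel γ t) (vel γ' t) : ℝ≥0∞) ∂halfLine

open Classical in
/-- The cost `F(γ, Q)` of the mean field game, equal to `⊤` if `γ` is not absolutely continuous,
if `Q` charges the curves that are not absolutely continuous, or if the pair cost is not
`Q`-integrable in its second argument. -/
def F (γ : Traj M.Ω) (Q : ProbabilityMeasure (Traj M.Ω)) : ℝ≥0∞ :=
  if IsAC γ ∧ (∀ᵐ γ' ∂(Q : Measure (Traj M.Ω)), IsAC γ') ∧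
      AEMeasurable (fun γ' => M.pairCost γ γ') (Q : Measure (Traj M.Ω)) ∧
      ∫⁻ γ', M.pairCost γ γ' ∂(Q : Measure (Traj M.Ω)) < ⊤
  then M.individualCost γ + ∫⁻ γ', M.pairCost γ γ' ∂(Q : Measure (Traj M.Ω))
  else ⊤

/-- Equilibria of the mean field game with initial condition `m₀`. -/
structure IsEquilibrium (m₀ : ProbabilityMeasure (closure M.Ω))
    (Q : ProbabilityMeasure (Traj M.Ω)) : Prop where
  marginal : (Q : Measure (Traj M.Ω)).map e₀ = (m₀ : Measure (closure M.Ω))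
  finite_cost : ∫⁻ γ, M.F γ Q ∂(Q : Measure (Traj M.Ω)) < ⊤
  optimal : ∀ᵐ γ ∂(Q : Measure (Traj M.Ω)),
    M.F γ Q = ⨅ (ω : Traj M.Ω) (_ : ω 0 = γ 0), M.F ω Q

/-- The assumptions (H1)--(H6), with `θ` the growth exponent that (H3) and (H4) share.
Measurability in time is meant in the sense of Lebesgue (equivalently, up to null sets). -/
structure Hypotheses (θ : ℝ) : Prop where
  -- (H1)
  Ω_nonempty : M.Ω.Nonempty
  Ω_open : IsOpen M.Ω
  Ω_bounded : Bornology.IsBounded M.Ω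
  -- (H2)
  Ξ_subset : M.Ξ ⊆ closure M.Ω
  Ξ_nonempty : M.Ξ.Nonempty
  Ξ_closed : IsClosed M.Ξ
  -- (H3)
  ℓ_measurable : ∀ x p, AEMeasurable (fun t => M.ℓ t x p) halfLine
  ℓ_continuous : ∀ᵐ t ∂halfLine,
    Continuous (fun z : closure M.Ω × EuclideanSpace ℝ (Fin d) => M.ℓ t z.1 z.2)
  ℓ_convex : ∀ᵐ t ∂halfLine, ∀ x, ConvexOn ℝ univ (fun p => (M.ℓ t x p : ℝ))
  one_lt_θ : 1 < θ
  ℓ_lower : ∃ α : ℝ, 0 < α ∧ ∀ t x p, α * ‖p‖ ^ θ ≤ (M.ℓ t x p : ℝ)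
  -- (H4)
  h_measurable : ∀ x x' p p', AEMeasurable (fun t => M.h t x x' p p') halfLine
  h_continuous : ∀ᵐ t ∂halfLine,
    Continuous (fun z : (closure M.Ω × closure M.Ω) ×
      (EuclideanSpace ℝ (Fin d) × EuclideanSpace ℝ (Fin d)) => M.h t z.1.1 z.1.2 z.2.1 z.2.2)
  h_convex : ∀ᵐ t ∂halfLine, ∀ x x', ConvexOn ℝ univ
    (fun q : EuclideanSpace ℝ (Fin d) × EuclideanSpace ℝ (Fin d) => (M.h t x x' q.1 q.2 : ℝ))
  h_symm : ∀ t x x' p p', M.h t x x' p p' = M.h t x' x p' p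
  h_upper : ∃ C β : ℝ, 0 < C ∧ 0 < β ∧ β ≤ θ ∧
    ∀ t x x' p p', (M.h t x x' p p' : ℝ) ≤ C * (‖p‖ ^ β + ‖p'‖ ^ β)
  -- (H5)
  Ψ_lsc : LowerSemicontinuous M.Ψ
  Ψ_mono : Monotone M.Ψ
  Ψ_lower : ∃ a b : ℝ, 0 < a ∧ 0 < b ∧ ∀ t : ℝ≥0, a * (t : ℝ) - b ≤ (M.Ψ t : ℝ)
  -- (H6)
  accessible : ∃ κ : ℝ≥0, 0 < κ ∧ ∀ x₀ : closure M.Ω,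
    ∃ γ : Traj M.Ω, IsAC γ ∧ γ 0 = x₀ ∧ M.individualCost γ ≤ κ

open Classical in
/-- The function `L` of the associated non-atomic game. -/
def L (γ : Traj M.Ω) : ℝ≥0∞ := if IsAC γ then M.individualCost γ else ⊤

open Classical in
/-- The function `H` of the associated non-atomic game. -/
def H (γ γ' : Traj M.Ω) : ℝ≥0∞ := if M.L γ < ⊤ ∧ M.L γ' < ⊤ then M.pairCost γ γ' else ⊤

/-- The non-atomic game associated with the mean field game. -/
def toNAG (m₀ : ProbabilityMeasure (closure M.Ω)) : NAG (Traj M.Ω) (closure M.Ω) where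
  π := e₀
  L := M.L
  H := M.H
  m₀ := m₀

end CrowdMFG

end

/-!
The assumptions on the non-atomic game rest on two semicontinuity facts: the individual cost `L` and
the cost `J` of a pair of curves are lower semicontinuous for locally uniform convergence.

For these the growth condition on `ℓ` only matters as superlinearity: for each `B` there is `R` with
`B ‖p‖ ≤ R + ℓ t x p`. It makes the velocities equi-integrable on each sublevel set of `L`
(`EquiAC`). Equi-integrability is equi-absolute continuity, so that limits of such curves are again
absolutely continuous (`EquiAC.isAC_of_mem_closure`), such families are equicontinuous, and
convergence of the curves implies `∫_S γₙ' → ∫_S γ'` for all bounded measurable `S`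
(`EquiAC.tendsto_setIntegral_vel`).

Lower semicontinuity is then Tonelli's theorem (`CoerciveIntegrand.lintegral_le_liminf`) for an
integrand `f t x p` that is Carathéodory, convex in `p` and superlinear. Superlinearity implies that
along a curve `f` is the supremum of countably many functions `a + b · p`, each of which stays below
`f` for all nearby states. For a single such function and a bounded set of times the inequality is
weak convergence; the set function `A ↦ liminf ∫_A f` is superadditive, and a superadditive set
function above countably many measures is above the measure whose density is the supremum of theirs
(`lintegral_iSup_le_of_superadditive`). For `L` one takes `f = ℓ`, and for `J` the sum of both
running costs and of the interaction stopped at a time `T` before both exit times. The exit time is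
lower semicontinuous because avoiding a closed set during a compact time interval is an open
condition.

Compactness of the sublevel sets of `L` is the Arzelà–Ascoli theorem, `H` is measurable as a
difference of semicontinuous functions, and `H γ ω ≤ C (L γ + L ω + 1)` because `L` controls the
exit time and `∫ ‖γ'‖ ^ θ`, while `‖p‖ ^ β ≤ 1 + ‖p‖ ^ θ`. Finally, `L` is below both costs, so it
is integrable at any equilibrium of either game; then almost all curves have finite `L`, and both
costs coincide.
-/

open Filter Topology

/-! ### Weak lower semicontinuity of convex integral functionals -/

/-- A superadditive set function which dominates each of countably many measures with densities
`ψ j` also dominates the measure with density `⨆ j, ψ j`. -/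
theorem lintegral_iSup_le_of_superadditive {α J : Type*} [MeasurableSpace α] {μ : Measure α}
    [Countable J] [Nonempty J] {m : Set α → ℝ≥0∞}
    (hm : ∀ A B, MeasurableSet A → MeasurableSet B → Disjoint A B → m A + m B ≤ m (A ∪ B))
    {ψ : J → α → ℝ≥0∞} (hψ : ∀ j, AEMeasurable (ψ j) μ)
    (h : ∀ j A, MeasurableSet A → ∫⁻ t in A, ψ j t ∂μ ≤ m A) :
    ∫⁻ t, ⨆ j, ψ j t ∂μ ≤ m univ := by
  obtain ⟨e, he⟩ := exists_surjective_nat J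
  let φ : ℕ → α → ℝ≥0∞ := fun n => (hψ (e n)).mk (ψ (e n))
  have hφ : ∀ n, Measurable (φ n) := fun n => (hψ (e n)).measurable_mk
  have hφe : ∀ n, ψ (e n) =ᵐ[μ] φ n := fun n => (hψ (e n)).ae_eq_mk
  have hsup : (fun t => ⨆ j, ψ j t) =ᵐ[μ] fun t => ⨆ n, partialSups φ n t := by
    filter_upwards [ae_all_iff.2 hφe] with t ht
    rw [← he.iSup_comp]
    simp_rw [ht]
    have := iSup_partialSups_eq φ
    rw [← iSup_apply, ← this, iSup_apply]
  have hpm : ∀ n, Measurable (partialSups φ n) := by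
    intro n
    induction n with
    | zero => simpa using hφ 0
    | succ n ih => rw [← Order.succ_eq_add_one, partialSups_succ]; exact ih.sup (hφ _)
  have key : ∀ n A, MeasurableSet A → ∫⁻ t in A, partialSups φ n t ∂μ ≤ m A := by
    intro n
    have h' : ∀ n A, MeasurableSet A → ∫⁻ t in A, φ n t ∂μ ≤ m A := fun n A hA => by
      rw [← lintegral_congr_ae (ae_restrict_of_ae (hφe n))]; exact h _ _ hA
    induction n with
    | zero => simpa using h' 0
    | succ n ih =>
      intro A hA
      -- split `A` according to which of the two functions realizes the maximum
      let D := {t | partialSups φ n t ≤ φ (n + 1) t}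
      have hD : MeasurableSet D := measurableSet_le (hpm n) (hφ _)
      rw [← inter_union_sdiff A D, lintegral_union (hA.diff hD) disjoint_sdiff_inter.symm]
      refine le_trans (add_le_add ?_ ?_)
        (hm _ _ (hA.inter hD) (hA.diff hD) disjoint_sdiff_inter.symm)
      · refine le_trans (le_of_eq ?_) (h' (n + 1) _ (hA.inter hD))
        refine setLIntegral_congr_fun (hA.inter hD) fun t ht => ?_
        rw [← Order.succ_eq_add_one, partialSups_succ]
        exact sup_eq_right.2 ht.2
      · refine le_trans (le_of_eq ?_) (ih _ (hA.diff hD))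
        refine setLIntegral_congr_fun (hA.diff hD) fun t ht => ?_
        rw [← Order.succ_eq_add_one, partialSups_succ]
        exact sup_eq_left.2 (not_le.1 ht.2).le
  rw [lintegral_congr_ae hsup, lintegral_iSup hpm
    (fun a b hab t => (partialSups φ).monotone hab t)]
  exact iSup_le fun n => by simpa using key n univ MeasurableSet.univ

theorem ofReal_integral_le_lintegral_ofReal {α : Type*} [MeasurableSpace α] {μ : Measure α}
    {g : α → ℝ} (hg : Integrable g μ) :
    ENNReal.ofReal (∫ t, g t ∂μ) ≤ ∫⁻ t, ENNReal.ofReal (g t) ∂μ := by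
  rw [integral_eq_lintegral_pos_part_sub_lintegral_neg_part hg]
  refine (ENNReal.ofReal_le_ofReal (sub_le_self _ ENNReal.toReal_nonneg)).trans ?_
  exact ENNReal.ofReal_toReal_le

theorem ENNReal.liminf_add_liminf_le {ι : Type*} {l : Filter ι} (u v : ι → ℝ≥0∞) :
    liminf u l + liminf v l ≤ liminf (u + v) l := by
  simp only [liminf_eq_iSup_iInf]
  refine ENNReal.biSup_add_biSup_le' ⟨univ, univ_mem⟩ ⟨univ, univ_mem⟩ fun s hs t ht => ?_
  refine le_trans ?_ (le_iSup₂ (s ∩ t) (inter_mem hs ht))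
  exact le_iInf₂ fun i hi => add_le_add (iInf₂_le i hi.1) (iInf₂_le i hi.2)

/-- Carathéodory integrands `f t x p`, convex and uniformly superlinear in the velocity `p`. -/
structure CoerciveIntegrand {Z V : Type*} [TopologicalSpace Z] [NormedAddCommGroup V]
    [NormedSpace ℝ V] (μ : Measure ℝ≥0) (f : ℝ≥0 → Z → V → ℝ≥0) : Prop where
  measurable : ∀ x p, AEMeasurable (fun t => f t x p) μ
  continuous : ∀ᵐ t ∂μ, Continuous (fun z : Z × V => f t z.1 z.2)
  convex : ∀ᵐ t ∂μ, ∀ x, ConvexOn ℝ univ (fun p => (f t x p : ℝ))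
  superlinear : ∀ B : ℝ, ∃ R : ℝ, ∀ t x p, B * ‖p‖ ≤ R + (f t x p : ℝ)

namespace CoerciveIntegrand

variable {Z V : Type*} [PseudoMetricSpace Z] [NormedAddCommGroup V]
  [NormedSpace ℝ V]

/-- The times at which `p ↦ a + b p` is below `f t x` for every `x` in the ball of centre `x₀`
and radius `r`. -/
def minorantSet (f : ℝ≥0 → Z → V → ℝ≥0) (x₀ : Z) (r : ℝ) (b : V →L[ℝ] ℝ) (a : ℝ) : Set ℝ≥0 :=
  {t | ∀ x ∈ Metric.ball x₀ r, ∀ p, a + b p ≤ (f t x p : ℝ)}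

variable {μ : Measure ℝ≥0} {f : ℝ≥0 → Z → V → ℝ≥0}

/-- By continuity it suffices to compare on a countable dense set of states and velocities. -/
theorem nullMeasurableSet_minorantSet [SecondCountableTopology Z] [SecondCountableTopology V]
    (hf : CoerciveIntegrand μ f) (x₀ : Z) (r : ℝ)
    (b : V →L[ℝ] ℝ) (a : ℝ) : NullMeasurableSet (minorantSet f x₀ r b a) μ := by
  obtain ⟨D, hDc, hDd⟩ := TopologicalSpace.exists_countable_dense (Z × V)
  let U : Set (Z × V) := Metric.ball x₀ r ×ˢ univ
  have hU : IsOpen U := Metric.isOpen_ball.prod isOpen_univ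
  have key : (⋂ q ∈ U ∩ D, {t | a + b q.2 ≤ (f t q.1 q.2 : ℝ)} : Set ℝ≥0)
      =ᵐ[μ] minorantSet f x₀ r b a := by
    rw [Filter.eventuallyEq_set]
    filter_upwards [hf.continuous] with t ht
    simp only [mem_iInter, minorantSet, mem_ofPred_eq]
    constructor
    · intro H x hx p
      have hcl : IsClosed {q : Z × V | a + b q.2 ≤ (f t q.1 q.2 : ℝ)} :=
        isClosed_le (by fun_prop) (NNReal.continuous_coe.comp ht)
      have : (x, p) ∈ closure (U ∩ D) :=
        hDd.open_subset_closure_inter hU ⟨hx, mem_univ _⟩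
      exact (closure_minimal (fun q hq => H q hq) hcl) this
    · exact fun H q hq => H q.1 hq.1.1 q.2
  refine NullMeasurableSet.congr ?_ key
  refine NullMeasurableSet.biInter (hDc.mono inter_subset_right) fun q _ => ?_
  exact nullMeasurableSet_le aemeasurable_const (hf.measurable _ _).coe_nnreal_real

/-- A convex, uniformly superlinear integrand has at every point almost optimal affine minorants
which persist in a neighbourhood of the state, with slope in a given dense set and rational
constant term. Superlinearity takes care of the large velocities, and the others form a compact
set. -/
theorem exists_affine_minorant [FiniteDimensional ℝ V] (hf : CoerciveIntegrand μ f) {t : ℝ≥0}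
    (hcont : Continuous (fun z : Z × V => f t z.1 z.2))
    (hconv : ∀ x, ConvexOn ℝ univ (fun p => (f t x p : ℝ)))
    {S : Set (V →L[ℝ] ℝ)} (hS : Dense S) (z₀ : Z) (p₀ : V) {c : ℝ} (hc : c < f t z₀ p₀) :
    ∃ b ∈ S, ∃ a : ℚ, c < a + b p₀ ∧
      ∀ᶠ x in 𝓝 z₀, ∀ p, a + b p ≤ (f t x p : ℝ) := by
  have : ProperSpace V := FiniteDimensional.proper ℝ V
  have hcz : Continuous (fun p : V => (f t z₀ p : ℝ)) :=
    NNReal.continuous_coe.comp (hcont.comp (by fun_prop : Continuous fun p : V => (z₀, p)))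
  -- an affine minorant `l + k` of `f t z₀` with a gap `c' - c` to spare at `p₀`
  obtain ⟨c', hcc', hc'⟩ := exists_between hc
  obtain ⟨l, k, hlk, hl₀⟩ := (hconv z₀).exists_affine_le_of_lt (𝕜 := ℝ) (mem_univ p₀) hc'
    isClosed_univ (hcz.lowerSemicontinuous.lowerSemicontinuousOn _)
  replace hlk : ∀ p, l p + k ≤ f t z₀ p := fun p => hlk ⟨p, mem_univ p⟩
  replace hl₀ : l p₀ + k = c' := hl₀
  obtain ⟨R, hR⟩ := hf.superlinear (‖l‖ + 2)
  -- beyond radius `ρ` superlinearity wins; within it the slope may be moved by `η`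
  set ρ : ℝ := |k| + |R| + ‖p₀‖ + 1 with hρ
  have hρ0 : 0 < ρ := by positivity
  set η : ℝ := min 1 ((c' - c) / (3 * ρ)) with hη
  have hη0 : 0 < η := lt_min one_pos (div_pos (by linarith) (by linarith))
  have hηρ : η * ρ ≤ (c' - c) / 3 := by
    calc η * ρ ≤ (c' - c) / (3 * ρ) * ρ := by gcongr; exact min_le_right _ _
      _ = (c' - c) / 3 := by field_simp
  obtain ⟨b, hbS, hb⟩ := Metric.dense_iff.1 hS l η hη0
  rw [Metric.mem_ball, dist_eq_norm] at hbS
  have hdiff : ∀ p, |b p - l p| ≤ η * ‖p‖ := fun p => by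
    have := (b - l).le_opNorm p
    simp only [_root_.sub_apply, Real.norm_eq_abs] at this
    exact this.trans (by gcongr)
  obtain ⟨a, ha1, ha2⟩ := exists_rat_btwn (show k - (c' - c) + η * ρ < k - η * ρ by linarith)
  refine ⟨b, hb, a, ?_, ?_⟩
  · have h1 := (abs_le.1 (hdiff p₀)).1
    have h2 : η * ‖p₀‖ ≤ η * ρ := by
      gcongr; rw [hρ]; linarith [abs_nonneg k, abs_nonneg R]
    linarith
  · have hball : ∀ p ∈ Metric.closedBall (0 : V) ρ,
        ∀ᶠ q : Z × V in 𝓝 (z₀, p), a + b q.2 < (f t q.1 q.2 : ℝ) := by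
      intro p hp
      refine ContinuousAt.eventually_lt (by fun_prop)
        (NNReal.continuous_coe.comp hcont).continuousAt ?_
      have h1 := (abs_le.1 (hdiff p)).2
      have h2 : η * ‖p‖ ≤ η * ρ := by
        gcongr; simpa using hp
      have h3 := hlk p
      change (a : ℝ) + b p < f t z₀ p
      linarith
    filter_upwards [(isCompact_closedBall (0 : V) ρ).eventually_forall_of_forall_eventually
      (P := fun x p => (a : ℝ) + b p < (f t x p : ℝ)) hball] with x hx p
    by_cases hp : p ∈ Metric.closedBall (0 : V) ρ
    · exact (hx p hp).le
    · have hp' : ρ < ‖p‖ := by simpa using hp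
      have h1 := hR t x p
      have h2 := (abs_le.1 (hdiff p)).2
      have h3 : η * ‖p‖ ≤ 1 * ‖p‖ := by gcongr; exact min_le_left _ _
      have h4 : l p ≤ ‖l‖ * ‖p‖ := (le_abs_self _).trans (l.le_opNorm p)
      have h5 := le_abs_self k
      have h6 := le_abs_self R
      have h7 : 0 ≤ η * ρ := by positivity
      nlinarith [norm_nonneg p₀]

/-- The indices of the countable family of local affine minorants: centre and radius of the ball
of states, slope, constant term, and time horizon. -/
abbrev Index : Type := ℕ × ℕ × ℕ × ℚ × ℕ

section Family

variable [SecondCountableTopology Z] [Nonempty Z] [FiniteDimensional ℝ V]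

/-- The slopes of the countable family of affine minorants. -/
noncomputable def slope (V : Type*) [NormedAddCommGroup V] [NormedSpace ℝ V] [FiniteDimensional ℝ V]
    (j : Index) : V →L[ℝ] ℝ :=
  haveI : ProperSpace (V →L[ℝ] ℝ) := FiniteDimensional.proper ℝ _
  TopologicalSpace.denseSeq (V →L[ℝ] ℝ) j.2.2.1

/-- The times `t` up to the horizon of `j` at which the affine function of index `j` is below `f`
for all states in a ball, and the curve `z` lies in the concentric ball of half the radius. -/
noncomputable def activeSet (f : ℝ≥0 → Z → V → ℝ≥0) (z : ℝ≥0 → Z) (j : Index) : Set ℝ≥0 :=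
  (minorantSet f (TopologicalSpace.denseSeq Z j.1) (2 / (j.2.1 + 1 : ℝ)) (slope V j) j.2.2.2.1 ∩
    z ⁻¹' Metric.ball (TopologicalSpace.denseSeq Z j.1) (1 / (j.2.1 + 1 : ℝ))) ∩
    Iic (j.2.2.2.2 : ℝ≥0)

/-- The positive part of the affine minorant of index `j` along the velocity `u`, at the times
where it is active. -/
noncomputable def minorant (f : ℝ≥0 → Z → V → ℝ≥0) (z : ℝ≥0 → Z) (u : ℝ≥0 → V) (j : Index)
    (t : ℝ≥0) : ℝ≥0∞ :=
  (activeSet f z j).indicator (fun t => ENNReal.ofReal (j.2.2.2.1 + slope V j (u t))) t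

theorem nullMeasurableSet_activeSet (hf : CoerciveIntegrand μ f) {z : ℝ≥0 → Z}
    (hz : Continuous z) (j : Index) : NullMeasurableSet (activeSet f z j) μ := by
  have : ProperSpace V := FiniteDimensional.proper ℝ V
  exact ((hf.nullMeasurableSet_minorantSet _ _ _ _).inter
    (Metric.isOpen_ball.preimage hz).measurableSet.nullMeasurableSet).inter
    measurableSet_Iic.nullMeasurableSet

theorem aemeasurable_minorant (hf : CoerciveIntegrand μ f) {z : ℝ≥0 → Z} (hz : Continuous z)
    {u : ℝ≥0 → V} (hu : AEStronglyMeasurable u μ) (j : Index) :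
    AEMeasurable (minorant f z u j) μ := by
  refine AEMeasurable.indicator₀ ?_ (hf.nullMeasurableSet_activeSet hz j)
  refine ENNReal.measurable_ofReal.comp_aemeasurable (AEMeasurable.const_add ?_ _)
  exact ((slope V j).continuous.comp_aestronglyMeasurable hu).aemeasurable

/-- Along a curve, the integrand is the supremum of its countably many local affine minorants. -/
theorem ae_eq_iSup_minorant (hf : CoerciveIntegrand μ f) (z : ℝ≥0 → Z) (u : ℝ≥0 → V) :
    (fun t => (f t (z t) (u t) : ℝ≥0∞)) =ᵐ[μ] fun t => ⨆ j, minorant f z u j t := by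
  filter_upwards [hf.continuous, hf.convex] with t hcont hconv
  apply le_antisymm
  · refine ENNReal.le_of_forall_nnreal_lt fun c hc => ?_
    have hc' : (c : ℝ) < f t (z t) (u t) := by exact_mod_cast hc
    have : ProperSpace (V →L[ℝ] ℝ) := FiniteDimensional.proper ℝ _
    obtain ⟨b, ⟨m, rfl⟩, a, hac, hev⟩ := hf.exists_affine_minorant hcont hconv
      (TopologicalSpace.denseRange_denseSeq (V →L[ℝ] ℝ)) (z t) (u t) hc'
    obtain ⟨ε, hε, hεb⟩ := Metric.eventually_nhds_iff_ball.1 hev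
    obtain ⟨k, hk⟩ := exists_nat_one_div_lt (show 0 < ε / 3 by positivity)
    have hk0 : (0 : ℝ) < 1 / (k + 1) := by positivity
    obtain ⟨n, hn⟩ := Metric.dense_iff.1 (TopologicalSpace.denseRange_denseSeq Z) (z t) _ hk0
    obtain ⟨hn, ⟨n, rfl⟩⟩ := hn
    obtain ⟨N, hN⟩ := exists_nat_ge t
    rw [Metric.mem_ball] at hn
    refine le_trans ?_ (le_iSup _ ((n, k, m, a, N) : Index))
    have hmem : t ∈ activeSet f z (n, k, m, a, N) := by
      refine ⟨⟨fun x hx p => hεb x ?_ p, ?_⟩, hN⟩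
      · rw [Metric.mem_ball] at hx ⊢
        have h2 : (2 : ℝ) / (k + 1) = 2 * (1 / (k + 1)) := by ring
        rw [h2] at hx
        linarith [dist_triangle x (TopologicalSpace.denseSeq Z n) (z t)]
      · rw [mem_preimage, Metric.mem_ball, dist_comm]; exact hn
    rw [minorant, indicator_of_mem hmem, ← ENNReal.ofReal_coe_nnreal]
    exact ENNReal.ofReal_le_ofReal hac.le
  · refine iSup_le fun j => ?_
    rw [minorant]
    by_cases ht : t ∈ activeSet f z j
    · rw [indicator_of_mem ht, ← ENNReal.ofReal_coe_nnreal]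
      refine ENNReal.ofReal_le_ofReal (ht.1.1 _ ?_ _)
      refine Metric.ball_subset_ball ?_ ht.1.2
      gcongr; norm_num
    · rw [indicator_of_notMem ht]; exact zero_le

theorem aemeasurable_comp (hf : CoerciveIntegrand μ f) {z : ℝ≥0 → Z} (hz : Continuous z)
    {u : ℝ≥0 → V} (hu : AEStronglyMeasurable u μ) :
    AEMeasurable (fun t => (f t (z t) (u t) : ℝ≥0∞)) μ :=
  (AEMeasurable.iSup fun j => hf.aemeasurable_minorant hz hu j).congr
    (hf.ae_eq_iSup_minorant z u).symm

/-- **Tonelli's lower semicontinuity theorem.** The functional `∫ f t (z t) (u t) dt` is lower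
semicontinuous under locally uniform convergence of the states `z` and weak convergence of the
velocities `u`. -/
theorem lintegral_le_liminf [IsFiniteMeasureOnCompacts μ]
    (hf : CoerciveIntegrand μ f) {ι : Type*} {l : Filter ι}
    {z : ℝ≥0 → Z} (hz : Continuous z) {u : ℝ≥0 → V} {zi : ι → ℝ≥0 → Z} {ui : ι → ℝ≥0 → V}
    (hzi : ∀ T, TendstoUniformlyOn zi z l (Iic T))
    (hu : ∀ T, IntegrableOn u (Iic T) μ) (hui : ∀ᶠ i in l, ∀ T, IntegrableOn (ui i) (Iic T) μ)
    (hum : AEStronglyMeasurable u μ)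
    (hw : ∀ T S, MeasurableSet S → S ⊆ Iic T →
      Tendsto (fun i => ∫ t in S, ui i t ∂μ) l (𝓝 (∫ t in S, u t ∂μ))) :
    ∫⁻ t, f t (z t) (u t) ∂μ ≤ liminf (fun i => ∫⁻ t, f t (zi i t) (ui i t) ∂μ) l := by
  rw [lintegral_congr_ae (hf.ae_eq_iSup_minorant z u)]
  have := lintegral_iSup_le_of_superadditive (μ := μ)
    (m := fun A => liminf (fun i => ∫⁻ t in A, f t (zi i t) (ui i t) ∂μ) l)
    (ψ := minorant f z u) ?_ (fun j => hf.aemeasurable_minorant hz hum j) ?_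
  · simpa using this
  · intro A B hA hB hAB
    refine (ENNReal.liminf_add_liminf_le _ _).trans
      (liminf_le_liminf (Eventually.of_forall fun i => ?_))
    simp only [Pi.add_apply]
    rw [lintegral_union hB hAB]
  · intro j A hA
    set T : ℝ≥0 := ((j.2.2.2.2 : ℕ) : ℝ≥0) with hT
    set a : ℝ := ((j.2.2.2.1 : ℚ) : ℝ) with ha
    set b := slope V j with hb
    have haff : ∀ v : ℝ≥0 → V, (∀ T, IntegrableOn v (Iic T) μ) → ∀ S ⊆ Iic T,
        IntegrableOn (fun t => a + b (v t)) S μ ∧ (MeasurableSet S →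
          ∫ t in S, (a + b (v t)) ∂μ = μ.real S * a + b (∫ t in S, v t ∂μ)) := by
      intro v hv S hS
      have hμS : μ S < ⊤ := by
        refine (measure_mono hS).trans_lt ?_
        rw [← Icc_bot]
        exact isCompact_Icc.measure_lt_top
      have h1 : IntegrableOn (fun _ : ℝ≥0 => a) S μ := integrableOn_const hμS.ne
      have h2 : IntegrableOn v S μ := (hv T).mono_set hS
      refine ⟨h1.add (b.integrable_comp h2), fun _ => ?_⟩
      rw [integral_add h1 (b.integrable_comp h2), b.integral_comp_comm h2]
      simp
    -- the part of `A` on which the minorant is active and positive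
    have hP : NullMeasurableSet (A ∩ activeSet f z j ∩ {t | 0 ≤ a + b (u t)}) μ := by
      refine (hA.nullMeasurableSet.inter (hf.nullMeasurableSet_activeSet hz j)).inter ?_
      exact nullMeasurableSet_le aemeasurable_const
        ((b.continuous.comp_aestronglyMeasurable hum).aemeasurable.const_add _)
    obtain ⟨S, hSP, hS, hSe⟩ := hP.exists_measurable_subset_ae_eq
    have hST : S ⊆ Iic T := fun t ht => (hSP ht).1.2.2
    have hle : ∫⁻ t in A, minorant f z u j t ∂μ ≤ ∫⁻ t in S, ENNReal.ofReal (a + b (u t)) ∂μ := by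
      rw [← lintegral_indicator hA, ← lintegral_indicator hS]
      refine lintegral_mono_ae ?_
      filter_upwards [Filter.eventuallyEq_set.1 hSe] with t ht
      by_cases htS : t ∈ S
      · rw [indicator_of_mem htS]
        refine (indicator_le_self _ _ _).trans ?_
        exact indicator_le_self _ _ _
      · rw [indicator_of_notMem htS, nonpos_iff_eq_zero]
        by_cases htA : t ∈ A
        · rw [indicator_of_mem htA, minorant]
          by_cases htj : t ∈ activeSet f z j
          · rw [indicator_of_mem htj, ENNReal.ofReal_eq_zero]
            by_contra hcon
            exact htS (ht.2 ⟨⟨htA, htj⟩, (not_le.1 hcon).le⟩)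
          · rw [indicator_of_notMem htj]
        · rw [indicator_of_notMem htA]
    refine hle.trans ?_
    rw [← ofReal_integral_eq_lintegral_ofReal (haff u hu S hST).1
      ((ae_restrict_iff' hS).2 (Eventually.of_forall fun t ht => (hSP ht).2))]
    have hlim : Tendsto (fun i => ENNReal.ofReal (∫ t in S, (a + b (ui i t)) ∂μ)) l
        (𝓝 (ENNReal.ofReal (∫ t in S, (a + b (u t)) ∂μ))) := by
      refine (ENNReal.continuous_ofReal.tendsto _).comp ?_
      rw [(haff u hu S hST).2 hS]
      refine Tendsto.congr' (hui.mono fun i hi => ((haff _ hi S hST).2 hS).symm) ?_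
      exact tendsto_const_nhds.add ((b.continuous.tendsto _).comp (hw T S hS hST))
    rcases eq_or_neBot l with rfl | hl
    · simp
    rw [← hlim.liminf_eq]
    refine liminf_le_liminf ?_
    have hr : (0 : ℝ) < 1 / (j.2.1 + 1) := by positivity
    filter_upwards [hui, Metric.tendstoUniformlyOn_iff.1 (hzi T) _ hr] with i hi hzi
    refine (ofReal_integral_le_lintegral_ofReal (haff _ hi S hST).1).trans ?_
    refine (setLIntegral_mono' hS fun t ht => ?_).trans
      (lintegral_mono_set fun t ht => (hSP ht).1.1)
    rw [← ENNReal.ofReal_coe_nnreal]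
    refine ENNReal.ofReal_le_ofReal ((hSP ht).1.2.1.1 _ ?_ _)
    have h1 := (hSP ht).1.2.1.2
    have h2 := hzi t (hST ht)
    rw [mem_preimage, Metric.mem_ball] at h1
    rw [Metric.mem_ball]
    have h3 : (2 : ℝ) / (j.2.1 + 1) = 1 / (j.2.1 + 1) + 1 / (j.2.1 + 1) := by ring
    rw [h3]
    rw [dist_comm] at h2
    linarith [dist_triangle (zi i t) (z t) (TopologicalSpace.denseSeq Z j.1)]

end Family

end CoerciveIntegrand

/-- A bound on a superlinear functional makes the velocities equi-integrable. -/
theorem CoerciveIntegrand.exists_setLIntegral_enorm_le {Z V : Type*} [TopologicalSpace Z]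
    [NormedAddCommGroup V] [NormedSpace ℝ V] {μ : Measure ℝ≥0} {f : ℝ≥0 → Z → V → ℝ≥0}
    (hf : CoerciveIntegrand μ f) (κ : ℝ≥0) {ε : ℝ≥0∞} (hε : 0 < ε) :
    ∃ δ : ℝ≥0∞, 0 < δ ∧ ∀ (z : ℝ≥0 → Z) (u : ℝ≥0 → V), ∫⁻ t, f t (z t) (u t) ∂μ ≤ κ →
      ∀ S, μ S ≤ δ → ∫⁻ t in S, ‖u t‖ₑ ∂μ ≤ ε := by
  obtain ⟨η, hη, hηε⟩ := ENNReal.lt_iff_exists_nnreal_btwn.1 hε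
  have hη0 : 0 < η := by exact_mod_cast hη
  obtain ⟨B, hB⟩ : ∃ B : ℝ≥0, B = 2 * (κ + 1) / η := ⟨_, rfl⟩
  have hB0 : 0 < B := hB ▸ by positivity
  obtain ⟨R, hR⟩ := hf.superlinear B
  -- with this choice the two terms below contribute at most `η / 2` each
  let R' : ℝ≥0 := R.toNNReal + 1
  refine ⟨(η * B / (2 * R') : ℝ≥0), by
    have : 0 < R' := by positivity
    exact_mod_cast (by positivity : 0 < η * B / (2 * R')), fun z u hzu S hS => ?_⟩
  refine le_trans ?_ hηε.le
  have hpt : ∀ t, (B : ℝ≥0∞) * ‖u t‖ₑ ≤ R' + f t (z t) (u t) := by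
    intro t
    have h1 : B * ‖u t‖₊ ≤ R' + f t (z t) (u t) := by
      rw [← NNReal.coe_le_coe]
      push_cast
      have := hR t (z t) (u t)
      have := Real.le_coe_toNNReal R
      simp only [R', NNReal.coe_add, NNReal.coe_one]
      linarith
    rw [enorm_eq_nnnorm]
    exact_mod_cast h1
  have hint : (B : ℝ≥0∞) * ∫⁻ t in S, ‖u t‖ₑ ∂μ ≤ (B * η : ℝ≥0) := by
    rw [← lintegral_const_mul' _ _ ENNReal.coe_ne_top]
    refine (lintegral_mono hpt).trans ?_
    rw [lintegral_add_left measurable_const, setLIntegral_const]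
    calc (R' : ℝ≥0∞) * μ S + ∫⁻ t in S, f t (z t) (u t) ∂μ
        ≤ R' * (η * B / (2 * R') : ℝ≥0) + κ := by
          gcongr
          exact (setLIntegral_le_lintegral _ _).trans hzu
      _ = (R' * (η * B / (2 * R')) + κ : ℝ≥0) := by push_cast; rfl
      _ ≤ (B * η : ℝ≥0) := by
          have hR' : R' ≠ 0 := by positivity
          have h1 : R' * (η * B / (2 * R')) = κ + 1 := by
            rw [hB]; field_simp
          have h2 : B * η = 2 * (κ + 1) := by rw [hB]; field_simp
          rw [h1, h2, ENNReal.coe_le_coe]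
          rw [← NNReal.coe_le_coe]; push_cast; linarith [κ.coe_nonneg]
  rw [ENNReal.coe_mul] at hint
  exact (ENNReal.mul_le_mul_iff_right (by exact_mod_cast hB0.ne') ENNReal.coe_ne_top).1 hint

/-! ### Absolutely continuous curves and their velocities -/

theorem measurableEmbedding_nnreal_coe : MeasurableEmbedding ((↑) : ℝ≥0 → ℝ) :=
  (MeasurableEmbedding.subtype_coe measurableSet_Ici : MeasurableEmbedding
    ((↑) : Set.Ici (0 : ℝ) → ℝ))

theorem measurePreserving_coe_halfLine :
    MeasurePreserving ((↑) : ℝ≥0 → ℝ) halfLine (volume.restrict (Ici 0)) where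
  measurable := measurable_coe_nnreal_real
  map_eq := by
    rw [halfLine, measurableEmbedding_nnreal_coe.map_comap]
    congr 1
    ext x
    exact ⟨fun ⟨y, hy⟩ => hy ▸ y.2, fun hx => ⟨⟨x, hx⟩, rfl⟩⟩

theorem halfLine_preimage_le (s : Set ℝ) :
    halfLine ((↑) ⁻¹' s : Set ℝ≥0) ≤ volume s := by
  rw [measurePreserving_coe_halfLine.measure_preimage_emb measurableEmbedding_nnreal_coe]
  exact Measure.restrict_apply_le _ _

theorem halfLine_Iic (T : ℝ≥0) : halfLine (Iic T) = T := by
  have : Iic T = ((↑) ⁻¹' Iic (T : ℝ) : Set ℝ≥0) := by ext; simp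
  rw [this, measurePreserving_coe_halfLine.measure_preimage_emb measurableEmbedding_nnreal_coe,
    Measure.restrict_apply measurableSet_Iic, inter_comm, Ici_inter_Iic]
  simp

instance : IsFiniteMeasureOnCompacts halfLine where
  lt_top_of_isCompact K hK := by
    obtain ⟨T, hT⟩ := hK.bddAbove
    exact (measure_mono hT : halfLine K ≤ _).trans_lt (by
      change halfLine (Iic T) < ⊤
      rw [halfLine_Iic]; exact ENNReal.coe_lt_top)

namespace Traj

variable {d : ℕ} {Ω : Set (EuclideanSpace ℝ (Fin d))}

theorem curve_coe (γ : Traj Ω) (t : ℝ≥0) : curve γ t = γ t := by simp [curve]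

theorem continuous_curve_apply (s : ℝ) : Continuous fun γ : Traj Ω => curve γ s :=
  continuous_subtype_val.comp (continuous_eval_const _)

theorem continuous_e₀ : Continuous (e₀ : Traj Ω → closure Ω) :=
  continuous_eval_const _

theorem stronglyMeasurable_vel (γ : Traj Ω) : StronglyMeasurable (vel γ) :=
  (stronglyMeasurable_deriv _).comp_measurable measurable_coe_nnreal_real

theorem _root_.AbsolutelyContinuousOnInterval.euclidean_apply {c : ℝ → EuclideanSpace ℝ (Fin d)}
    {a b : ℝ} (hc : AbsolutelyContinuousOnInterval c a b) (i : Fin d) :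
    AbsolutelyContinuousOnInterval (fun s => c s i) a b := by
  rw [absolutelyContinuousOnInterval_iff] at hc ⊢
  intro ε hε
  obtain ⟨δ, hδ, h⟩ := hc ε hε
  refine ⟨δ, hδ, fun E hE hlt => lt_of_le_of_lt ?_ (h E hE hlt)⟩
  refine Finset.sum_le_sum fun j _ => ?_
  rw [dist_eq_norm, dist_eq_norm]
  exact PiLp.norm_apply_le (c (E.2 j).1 - c (E.2 j).2) i

theorem _root_.AbsolutelyContinuousOnInterval.deriv_euclidean
    {c : ℝ → EuclideanSpace ℝ (Fin d)}
    {a b : ℝ} (hc : AbsolutelyContinuousOnInterval c a b) (i : Fin d) :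
    ∀ᵐ s, s ∈ uIoc a b → deriv (fun s => c s i) s = deriv c s i := by
  have h := ae_all_iff.2 fun j => (hc.euclidean_apply j).ae_differentiableAt
  filter_upwards [h] with s hs hsab
  have hd : DifferentiableAt ℝ c s :=
    differentiableAt_euclidean.2 fun j => hs j (uIoc_subset_uIcc hsab)
  have := (hasDerivAt_pi.1 ((PiLp.continuousLinearEquiv 2 ℝ
    (fun _ : Fin d => ℝ)).toContinuousLinearMap.hasFDerivAt.comp_hasDerivAt s hd.hasDerivAt)) i
  exact this.deriv

theorem _root_.AbsolutelyContinuousOnInterval.intervalIntegrable_deriv_euclidean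
    {c : ℝ → EuclideanSpace ℝ (Fin d)} {a b : ℝ} (hc : AbsolutelyContinuousOnInterval c a b) :
    IntervalIntegrable (deriv c) volume a b := by
  rw [intervalIntegrable_iff]
  refine Integrable.of_eval_piLp fun i => ?_
  have := intervalIntegrable_iff.1 (hc.euclidean_apply i).intervalIntegrable_deriv
  refine this.congr ?_
  exact (ae_restrict_iff' measurableSet_uIoc).2 (hc.deriv_euclidean i)

theorem _root_.AbsolutelyContinuousOnInterval.integral_deriv_eq_sub_euclidean
    {c : ℝ → EuclideanSpace ℝ (Fin d)} {a b : ℝ} (hc : AbsolutelyContinuousOnInterval c a b) :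
    ∫ s in a..b, deriv c s = c b - c a := by
  ext i
  have h1 := (hc.euclidean_apply i).integral_deriv_eq_sub
  have h2 := hc.intervalIntegrable_deriv_euclidean
  have h3 := (EuclideanSpace.proj (𝕜 := ℝ) (ι := Fin d) i).intervalIntegral_comp_comm h2
  simp only [EuclideanSpace.coe_proj] at h3
  rw [← h3, PiLp.sub_apply, ← h1]
  refine intervalIntegral.integral_congr_ae ?_
  filter_upwards [hc.deriv_euclidean i] with s hs hsab
  exact (hs hsab).symm

theorem IsAC.absolutelyContinuousOnInterval {γ : Traj Ω} (hγ : IsAC γ) {a b : ℝ} (ha : 0 ≤ a)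
    (hb : 0 ≤ b) : AbsolutelyContinuousOnInterval (curve γ) a b := by
  refine (hγ (max a b) (ha.trans (le_max_left _ _))).mono ?_
  rw [uIcc_of_le (ha.trans (le_max_left a b))]
  exact uIcc_subset_Icc ⟨ha, le_max_left _ _⟩ ⟨hb, le_max_right _ _⟩

theorem IsAC.integrableOn_vel {γ : Traj Ω} (hγ : IsAC γ) (T : ℝ≥0) :
    IntegrableOn (vel γ) (Iic T) halfLine := by
  have hT : Iic T = ((↑) ⁻¹' Icc 0 (T : ℝ) : Set ℝ≥0) := by ext; simp
  have := (hγ.absolutelyContinuousOnInterval le_rfl T.coe_nonneg).intervalIntegrable_deriv_euclidean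
  rw [intervalIntegrable_iff_integrableOn_Icc_of_le T.coe_nonneg] at this
  rw [hT]
  refine (measurePreserving_coe_halfLine.integrableOn_comp_preimage
    measurableEmbedding_nnreal_coe).2 ?_
  rwa [IntegrableOn, Measure.restrict_restrict measurableSet_Icc,
    inter_eq_left.2 (fun x hx => hx.1)]

theorem IsAC.setIntegral_vel {γ : Traj Ω} (hγ : IsAC γ) (T : ℝ≥0) :
    ∫ t in Iic T, vel γ t ∂halfLine = (γ T : EuclideanSpace ℝ (Fin d)) - γ 0 := by
  have hT : Iic T = ((↑) ⁻¹' Icc 0 (T : ℝ) : Set ℝ≥0) := by ext; simp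
  have := (hγ.absolutelyContinuousOnInterval le_rfl T.coe_nonneg).integral_deriv_eq_sub_euclidean
  rw [intervalIntegral.integral_of_le T.coe_nonneg, ← integral_Icc_eq_integral_Ioc,
    curve_coe] at this
  have h0 : curve γ 0 = γ 0 := by simp [curve]
  rw [h0] at this
  rw [← this, hT]
  simp only [vel]
  rw [measurePreserving_coe_halfLine.setIntegral_preimage_emb measurableEmbedding_nnreal_coe,
    Measure.restrict_restrict measurableSet_Icc, inter_eq_left.2 (fun x hx => hx.1)]

theorem IsAC.edist_curve_le {γ : Traj Ω} (hγ : IsAC γ) {a b : ℝ} (ha : 0 ≤ a) (hb : 0 ≤ b) :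
    edist (curve γ a) (curve γ b) ≤ ∫⁻ t in (↑) ⁻¹' uIoc a b, ‖vel γ t‖ₑ ∂halfLine := by
  have h := (hγ.absolutelyContinuousOnInterval ha hb).integral_deriv_eq_sub_euclidean
  have hsub : uIoc a b ∩ Ici 0 = uIoc a b := inter_eq_left.2 fun x hx => by
    rcases le_total a b with hab | hab
    · rw [uIoc_of_le hab] at hx; exact ha.trans hx.1.le
    · rw [uIoc_of_ge hab] at hx; exact hb.trans hx.1.le
  simp only [vel]
  rw [measurePreserving_coe_halfLine.setLIntegral_comp_preimage_emb measurableEmbedding_nnreal_coe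
    (fun s => ‖deriv (curve γ) s‖ₑ), Measure.restrict_restrict measurableSet_uIoc, hsub,
    edist_comm, edist_eq_enorm_sub, ← h]
  have : ‖∫ s in a..b, deriv (curve γ) s‖ₑ = ‖∫ s in uIoc a b, deriv (curve γ) s‖ₑ := by
    rw [← ofReal_norm, ← ofReal_norm, intervalIntegral.norm_intervalIntegral_eq]
  rw [this]
  exact enorm_integral_le_lintegral_enorm _

/-- A set of absolutely continuous curves whose velocities are equi-integrable. -/
def EquiAC (K : Set (Traj Ω)) : Prop :=
  (∀ γ ∈ K, IsAC γ) ∧ ∀ ε : ℝ≥0∞, 0 < ε → ∃ δ : ℝ≥0∞, 0 < δ ∧ ∀ γ ∈ K, ∀ S, MeasurableSet S →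
    halfLine S ≤ δ → ∫⁻ t in S, ‖vel γ t‖ₑ ∂halfLine ≤ ε

/-- Equi-integrability of the velocities is an equi-absolute continuity, which only involves the
values of the curves at finitely many times and hence survives pointwise limits. -/
theorem EquiAC.isAC_of_mem_closure {K : Set (Traj Ω)} (hK : EquiAC K) {γ : Traj Ω}
    (hγ : γ ∈ closure K) : IsAC γ := by
  intro T hT
  rw [absolutelyContinuousOnInterval_iff]
  intro ε hε
  obtain ⟨δ, hδ, h⟩ := hK.2 (ENNReal.ofReal (ε / 2)) (by positivity)
  obtain ⟨δ', -, hδ'0, hδ'⟩ := ENNReal.lt_iff_exists_real_btwn.1 hδ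
  have hδ'0 : 0 < δ' := by simpa using hδ'0
  refine ⟨δ', hδ'0, fun E hE hlt => ?_⟩
  have hcl : IsClosed {γ : Traj Ω | ∑ i ∈ Finset.range E.1,
      dist (curve γ (E.2 i).1) (curve γ (E.2 i).2) ≤ ε / 2} :=
    isClosed_le (continuous_finsetSum _ fun i _ =>
      (continuous_curve_apply _).dist (continuous_curve_apply _)) continuous_const
  refine lt_of_le_of_lt (closure_minimal (fun γ hγ => ?_) hcl hγ) (half_lt_self hε)
  have hmem : ∀ i ∈ Finset.range E.1, 0 ≤ (E.2 i).1 ∧ 0 ≤ (E.2 i).2 := fun i hi => by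
    have := hE.1 i hi
    rw [uIcc_of_le hT] at this
    exact ⟨this.1.1, this.2.1⟩
  set S : Set ℝ := ⋃ i ∈ Finset.range E.1, uIoc (E.2 i).1 (E.2 i).2 with hS
  have hvol : volume S ≤ δ := by
    refine le_trans ?_ hδ'.le
    refine (measure_biUnion_finset_le _ _).trans ?_
    refine le_trans (le_of_eq ?_) (ENNReal.ofReal_le_ofReal hlt.le)
    rw [ENNReal.ofReal_sum_of_nonneg (fun _ _ => dist_nonneg)]
    refine Finset.sum_congr rfl fun i _ => ?_
    simp [uIoc, Real.dist_eq, max_sub_min_eq_abs']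
  have hle : ∑ i ∈ Finset.range E.1, edist (curve γ (E.2 i).1) (curve γ (E.2 i).2) ≤
      ENNReal.ofReal (ε / 2) := by
    have hmeas : MeasurableSet S :=
      Finset.measurableSet_biUnion _ fun i _ => measurableSet_uIoc
    refine le_trans ?_ (h γ hγ ((↑) ⁻¹' S) (measurable_coe_nnreal_real hmeas)
      ((halfLine_preimage_le S).trans hvol))
    rw [hS]
    simp only [preimage_iUnion]
    rw [lintegral_biUnion_finset]
    · exact Finset.sum_le_sum fun i hi =>
        (hK.1 γ hγ).edist_curve_le (hmem i hi).1 (hmem i hi).2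
    · intro i hi j hj hij
      exact (hE.2 hi hj hij).preimage _
    · exact fun i _ => measurable_coe_nnreal_real measurableSet_uIoc
  simp_rw [edist_dist] at hle
  rw [← ENNReal.ofReal_sum_of_nonneg (fun _ _ => dist_nonneg)] at hle
  exact (ENNReal.ofReal_le_ofReal_iff (by positivity)).1 hle

theorem EquiAC.equicontinuous {K : Set (Traj Ω)} (hK : EquiAC K) :
    Equicontinuous (fun (γ : K) (t : ℝ≥0) => (γ : Traj Ω) t) := by
  intro t₀
  rw [Metric.equicontinuousAt_iff]
  intro ε hε
  obtain ⟨δ, hδ, h⟩ := hK.2 (ENNReal.ofReal (ε / 2)) (by positivity)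
  obtain ⟨δ', -, hδ'0, hδ'⟩ := ENNReal.lt_iff_exists_real_btwn.1 hδ
  have hδ'0 : 0 < δ' := by simpa using hδ'0
  refine ⟨δ', hδ'0, fun t ht γ => ?_⟩
  have h1 := (hK.1 γ γ.2).edist_curve_le t₀.coe_nonneg t.coe_nonneg
  have h2 := h1.trans (h γ γ.2 _ (measurable_coe_nnreal_real measurableSet_uIoc)
    ((halfLine_preimage_le _).trans (le_trans ?_ hδ'.le)))
  · change edist (curve _ (t₀ : ℝ)) (curve _ (t : ℝ)) ≤ _ at h2
    rw [curve_coe, curve_coe, edist_dist, ENNReal.ofReal_le_ofReal_iff (by positivity)] at h2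
    exact lt_of_le_of_lt h2 (half_lt_self hε)
  · rw [NNReal.dist_eq] at ht
    rw [Real.volume_uIoc]
    exact ENNReal.ofReal_le_ofReal ht.le

/-- If curves with equi-integrable velocities converge, then their velocities converge weakly. -/
theorem EquiAC.tendsto_setIntegral_vel {K : Set (Traj Ω)} (hK : EquiAC K) {γ : Traj Ω}
    (hγ : IsAC γ) {l : Filter (Traj Ω)} (hl : l ≤ 𝓝 γ) (hlK : K ∈ l) (T : ℝ≥0) {S : Set ℝ≥0}
    (hS : MeasurableSet S) (hST : S ⊆ Iic T) :
    Tendsto (fun ω => ∫ t in S, vel ω t ∂halfLine) l (𝓝 (∫ t in S, vel γ t ∂halfLine)) := by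
  have hbase : ∀ a : ℝ≥0, Tendsto (fun ω => ∫ t in Iic a, vel ω t ∂halfLine) l
      (𝓝 (∫ t in Iic a, vel γ t ∂halfLine)) := by
    intro a
    rw [hγ.setIntegral_vel]
    refine Tendsto.congr' (f₁ := fun ω : Traj Ω => (ω a : EuclideanSpace ℝ (Fin d)) - ω 0) ?_ ?_
    · filter_upwards [hlK] with ω hω
      exact ((hK.1 ω hω).setIntegral_vel a).symm
    · have : Continuous fun ω : Traj Ω => (ω a : EuclideanSpace ℝ (Fin d)) - ω 0 :=
        (continuous_subtype_val.comp (continuous_eval_const a)).sub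
          (continuous_subtype_val.comp (continuous_eval_const 0))
      exact (this.tendsto γ).mono_left hl
  suffices H : Tendsto (fun ω => ∫ t in S ∩ Iic T, vel ω t ∂halfLine) l
      (𝓝 (∫ t in S ∩ Iic T, vel γ t ∂halfLine)) by rwa [inter_eq_left.2 hST] at H
  clear hST
  induction S, hS using MeasurableSpace.induction_on_inter
    (borel_eq_generateFrom_Iic ℝ≥0 ▸ BorelSpace.measurable_eq) isPiSystem_Iic with
  | empty => simpa using tendsto_const_nhds
  | basic S hS =>
    obtain ⟨a, rfl⟩ := hS
    rw [Iic_inter_Iic]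
    exact hbase _
  | compl S hS ih =>
    have hdiff : ∀ ω : Traj Ω, IsAC ω → ∫ t in Sᶜ ∩ Iic T, vel ω t ∂halfLine =
        (∫ t in Iic T, vel ω t ∂halfLine) - ∫ t in S ∩ Iic T, vel ω t ∂halfLine := by
      intro ω hω
      have := integral_inter_add_sdiff hS (hω.integrableOn_vel T)
      rw [← this, inter_comm (Iic T) S, sdiff_eq, inter_comm (Iic T)]
      abel
    rw [hdiff γ hγ]
    refine Tendsto.congr' ?_ ((hbase T).sub ih)
    filter_upwards [hlK] with ω hω
    exact (hdiff ω (hK.1 ω hω)).symm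
  | iUnion S hdisj hS ih =>
    -- finite unions approximate the whole union up to a set of small measure
    set A : ℕ → Set ℝ≥0 := fun n => (⋃ k ∈ Finset.range n, S k) ∩ Iic T with hA
    set B : Set ℝ≥0 := (⋃ k, S k) ∩ Iic T with hB
    have hAm : ∀ n, MeasurableSet (A n) := fun n =>
      (Finset.measurableSet_biUnion _ fun k _ => hS k).inter measurableSet_Iic
    have hBm : MeasurableSet B := (MeasurableSet.iUnion hS).inter measurableSet_Iic
    have hAB : ∀ n, A n ⊆ B := fun n =>
      inter_subset_inter_left _ (iUnion₂_subset fun k _ => subset_iUnion S k)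
    have hAmono : Monotone A := fun m n hmn => inter_subset_inter_left _
      (biUnion_subset_biUnion_left fun k hk => by
        simp only [Finset.coe_range, mem_Iio] at hk ⊢
        exact lt_of_lt_of_le hk hmn)
    have hAU : ⋃ n, A n = B := by
      rw [hA, hB, ← iUnion_inter]
      congr 1
      ext t
      simp only [mem_iUnion, Finset.mem_range]
      exact ⟨fun ⟨_, k, _, h⟩ => ⟨k, h⟩, fun ⟨k, h⟩ => ⟨k + 1, k, k.lt_succ_self, h⟩⟩
    have hAlim : ∀ n, Tendsto (fun ω => ∫ t in A n, vel ω t ∂halfLine) l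
        (𝓝 (∫ t in A n, vel γ t ∂halfLine)) := by
      intro n
      have hsum : ∀ ω : Traj Ω, IsAC ω → ∫ t in A n, vel ω t ∂halfLine =
          ∑ k ∈ Finset.range n, ∫ t in S k ∩ Iic T, vel ω t ∂halfLine := by
        intro ω hω
        simp only [hA, iUnion₂_inter]
        refine integral_biUnion_finset _ (fun k _ => (hS k).inter measurableSet_Iic) ?_ ?_
        · intro i _ j _ hij
          exact (hdisj hij).mono inter_subset_left inter_subset_left
        · exact fun k _ => (hω.integrableOn_vel T).mono_set inter_subset_right
      rw [hsum γ hγ]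
      refine Tendsto.congr' ?_ (tendsto_finsetSum _ fun k _ => ih k)
      filter_upwards [hlK] with ω hω
      exact (hsum ω (hK.1 ω hω)).symm
    have hmeas0 : Tendsto (fun n => halfLine (B \ A n)) atTop (𝓝 0) := by
      have hfin : halfLine (B \ A 0) ≠ ⊤ := by
        refine ((measure_mono (sdiff_subset.trans inter_subset_right)).trans_lt
          (?_ : halfLine (Iic T) < ⊤)).ne
        rw [halfLine_Iic]; exact ENNReal.coe_lt_top
      have := tendsto_measure_iInter_atTop (μ := halfLine) (s := fun n => B \ A n)
        (fun n => (hBm.diff (hAm n)).nullMeasurableSet)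
        (fun m n hmn => sdiff_subset_sdiff_right (hAmono hmn)) ⟨0, hfin⟩
      rwa [← sdiff_iUnion, hAU, _root_.sdiff_self, bot_eq_empty, measure_empty] at this
    have hγlim : Tendsto (fun n => ∫ t in A n, vel γ t ∂halfLine) atTop
        (𝓝 (∫ t in B, vel γ t ∂halfLine)) := by
      rw [← hAU]
      refine tendsto_setIntegral_of_monotone hAm hAmono ?_
      rw [hAU]
      exact (hγ.integrableOn_vel T).mono_set inter_subset_right
    rw [Metric.tendsto_nhds]
    intro ε hε
    obtain ⟨δ, hδ, h⟩ := hK.2 (ENNReal.ofReal (ε / 4)) (by positivity)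
    obtain ⟨n, hn1, hn2⟩ := ((hmeas0.eventually (ge_mem_nhds hδ)).and
      (Metric.tendsto_nhds.1 hγlim (ε / 4) (by positivity))).exists
    filter_upwards [hlK, Metric.tendsto_nhds.1 (hAlim n) (ε / 4) (by positivity)] with ω hω hn3
    have h4 : dist (∫ t in B, vel ω t ∂halfLine) (∫ t in A n, vel ω t ∂halfLine) ≤ ε / 4 := by
      have hint : IntegrableOn (vel ω) B halfLine :=
        ((hK.1 ω hω).integrableOn_vel T).mono_set inter_subset_right
      rw [dist_eq_norm, ← setIntegral_sdiff (hAm n) hint (hAB n)]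
      have h5 := (enorm_integral_le_lintegral_enorm _).trans
        (h ω hω _ (hBm.diff (hAm n)) hn1)
      rwa [← ofReal_norm, ENNReal.ofReal_le_ofReal_iff (by positivity)] at h5
    have := dist_triangle4 (∫ t in B, vel ω t ∂halfLine) (∫ t in A n, vel ω t ∂halfLine)
      (∫ t in A n, vel γ t ∂halfLine) (∫ t in B, vel γ t ∂halfLine)
    linarith

end Traj

namespace CrowdMFG

open Traj

variable {d : ℕ} {M : CrowdMFG d} {θ : ℝ}

/-! ### The exit time and the final cost -/

theorem le_τ_of_mapsTo {γ : Traj M.Ω} {c : ℝ≥0}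
    (h : MapsTo γ (Iic c) {x | (x : EuclideanSpace ℝ (Fin d)) ∈ M.Ξ}ᶜ) : (c : ℝ≥0∞) ≤ M.τ γ := by
  refine le_iInf₂ fun t ht => ?_
  by_contra hcon
  exact h (by exact_mod_cast (not_le.1 hcon).le) ht

theorem lowerSemicontinuous_τ (hΞ : IsClosed M.Ξ) : LowerSemicontinuous M.τ := by
  intro γ y hy
  obtain ⟨c, hyc, hc⟩ := ENNReal.lt_iff_exists_nnreal_btwn.1 hy
  have hmaps : MapsTo γ (Iic c) {x : closure M.Ω | (x : EuclideanSpace ℝ (Fin d)) ∈ M.Ξ}ᶜ := by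
    intro t ht hmem
    refine absurd hc (not_lt.2 ((iInf₂_le t hmem).trans ?_))
    exact_mod_cast ht
  have hK : IsCompact (Iic c) := by rw [← Icc_bot]; exact isCompact_Icc
  filter_upwards [ContinuousMap.eventually_mapsTo hK
    (hΞ.preimage continuous_subtype_val).isOpen_compl hmaps] with ω hω
  exact hyc.trans_le (le_τ_of_mapsTo hω)

theorem Ψext_coe (t : ℝ≥0) : M.Ψext t = M.Ψ t := by simp [Ψext]

theorem Ψext_top : M.Ψext ⊤ = ⊤ := by simp [Ψext]

theorem monotone_Ψext (hΨ : Monotone M.Ψ) : Monotone M.Ψext := by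
  intro s t hst
  induction t with
  | top => rw [Ψext_top]; exact le_top
  | coe t =>
    lift s to ℝ≥0 using ne_top_of_le_ne_top ENNReal.coe_ne_top hst
    rw [Ψext_coe, Ψext_coe]
    exact_mod_cast hΨ (by exact_mod_cast hst)

/-- The final cost controls the time. -/
theorem Hypotheses.exists_le_Ψext (hM : M.Hypotheses θ) :
    ∃ c₁ c₂ : ℝ≥0, ∀ s, s ≤ c₁ * M.Ψext s + c₂ := by
  obtain ⟨a, b, ha, hb, hab⟩ := hM.Ψ_lower
  lift a to ℝ≥0 using ha.le
  lift b to ℝ≥0 using hb.le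
  have ha' : 0 < a := by exact_mod_cast ha
  refine ⟨a⁻¹, a⁻¹ * b, fun s => ?_⟩
  induction s with
  | top =>
    rw [Ψext_top, ENNReal.mul_top (by exact_mod_cast (inv_pos.2 ha').ne')]
    simp
  | coe t =>
    rw [Ψext_coe]
    norm_cast
    rw [← mul_add, ← NNReal.coe_le_coe]
    push_cast
    rw [inv_mul_eq_div, le_div_iff₀ ha]
    linarith [hab t]

theorem Hypotheses.lowerSemicontinuous_Ψext (hM : M.Hypotheses θ) :
    LowerSemicontinuous M.Ψext := by
  intro s y hy
  induction s with
  | top =>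
    obtain ⟨c₁, c₂, hc⟩ := hM.exists_le_Ψext
    lift y to ℝ≥0 using (hy.trans_le le_top).ne
    filter_upwards [eventually_gt_nhds (show ((c₁ * y + c₂ : ℝ≥0) : ℝ≥0∞) < ⊤ from
      ENNReal.coe_lt_top)] with s hs
    by_contra hcon
    refine absurd (hs.trans_le (hc s)) (not_lt.2 ?_)
    push_cast
    gcongr
    exact not_lt.1 hcon
  | coe t =>
    rw [Ψext_coe] at hy
    lift y to ℝ≥0 using (hy.trans_le le_top).ne
    rw [ENNReal.nhds_coe, eventually_map]
    filter_upwards [hM.Ψ_lsc t y (by exact_mod_cast hy)] with s hs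
    rw [Ψext_coe]
    exact_mod_cast hs

/-- A monotone lower semicontinuous function of a lower semicontinuous function is lower
semicontinuous. -/
theorem Hypotheses.lowerSemicontinuous_Ψext_τ (hM : M.Hypotheses θ) :
    LowerSemicontinuous fun γ => M.Ψext (M.τ γ) := by
  have hmono := monotone_Ψext hM.Ψ_mono
  intro γ y hy
  rcases eq_or_ne (M.τ γ) 0 with h0 | h0
  · exact Eventually.of_forall fun ω => hy.trans_le (hmono (h0 ▸ zero_le))
  obtain ⟨s, hs, hsy⟩ := exists_Ioc_subset_of_mem_nhds (hM.lowerSemicontinuous_Ψext _ y hy)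
    ⟨0, pos_iff_ne_zero.2 h0⟩
  filter_upwards [lowerSemicontinuous_τ hM.Ξ_closed γ s hs] with ω hω
  have h : y < M.Ψext (min (M.τ ω) (M.τ γ)) := hsy ⟨lt_min hω hs, min_le_right _ _⟩
  exact h.trans_le (hmono (min_le_left _ _))

/-! ### The running cost -/

/-- Superlinear growth of the running cost, in the form needed for semicontinuity and compactness. -/
theorem Hypotheses.ℓ_superlinear (hM : M.Hypotheses θ) (B : ℝ) :
    ∃ R : ℝ, 0 ≤ R ∧ ∀ t x p, B * ‖p‖ ≤ R + (M.ℓ t x p : ℝ) := by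
  obtain ⟨α, hα, h⟩ := hM.ℓ_lower
  have hθ := hM.one_lt_θ
  obtain ⟨r, hr0, hr⟩ := ((eventually_gt_atTop 0).and
    ((tendsto_rpow_atTop (sub_pos.2 hθ)).eventually_ge_atTop (|B| / α))).exists
  refine ⟨|B| * r, by positivity, fun t x p => ?_⟩
  have h0 : B * ‖p‖ ≤ |B| * ‖p‖ := by gcongr; exact le_abs_self B
  refine h0.trans ?_
  rcases le_total ‖p‖ r with hp | hp
  · have : |B| * ‖p‖ ≤ |B| * r := by gcongr
    linarith [(M.ℓ t x p).coe_nonneg]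
  · have hp0 : 0 < ‖p‖ := hr0.trans_le hp
    have h1 : |B| / α ≤ ‖p‖ ^ (θ - 1) :=
      hr.trans (Real.rpow_le_rpow hr0.le hp (sub_pos.2 hθ).le)
    have h2 : |B| * ‖p‖ ≤ α * ‖p‖ ^ θ := by
      have h3 : ‖p‖ ^ θ = ‖p‖ ^ (θ - 1) * ‖p‖ := by
        rw [← Real.rpow_add_one hp0.ne', sub_add_cancel]
      rw [h3, ← mul_assoc]
      rw [div_le_iff₀' hα] at h1
      gcongr
    have : 0 ≤ |B| * r := by positivity
    linarith [h t x p]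

theorem Hypotheses.coerciveIntegrand_ℓ (hM : M.Hypotheses θ) :
    CoerciveIntegrand halfLine M.ℓ where
  measurable := hM.ℓ_measurable
  continuous := hM.ℓ_continuous
  convex := hM.ℓ_convex
  superlinear B := (hM.ℓ_superlinear B).imp fun _ h => h.2

theorem Hypotheses.nonempty_closure (hM : M.Hypotheses θ) : Nonempty (closure M.Ω) :=
  hM.Ω_nonempty.closure.to_subtype

theorem Hypotheses.aemeasurable_ℓ (hM : M.Hypotheses θ) (γ : Traj M.Ω) :
    AEMeasurable (fun t => (M.ℓ t (γ t) (vel γ t) : ℝ≥0∞)) halfLine := by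
  have := hM.nonempty_closure
  exact hM.coerciveIntegrand_ℓ.aemeasurable_comp γ.continuous
    (stronglyMeasurable_vel γ).aestronglyMeasurable

/-- The cost of a pair of curves before time `T`: the sum of both running costs, plus the
interaction cost at the times before `T`, as an integrand on the product space. -/
noncomputable def pairIntegrand (M : CrowdMFG d) (T : ℝ≥0) (t : ℝ≥0)
    (z : closure M.Ω × closure M.Ω)
    (q : EuclideanSpace ℝ (Fin d) × EuclideanSpace ℝ (Fin d)) : ℝ≥0 :=
  M.ℓ t z.1 q.1 + M.ℓ t z.2 q.2 + if t < T then M.h t z.1 z.2 q.1 q.2 else 0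

theorem Hypotheses.coerciveIntegrand_pairIntegrand (hM : M.Hypotheses θ) (T : ℝ≥0) :
    CoerciveIntegrand halfLine (M.pairIntegrand T) where
  measurable z q := by
    refine ((hM.ℓ_measurable _ _).add (hM.ℓ_measurable _ _)).add ?_
    exact (hM.h_measurable z.1 z.2 q.1 q.2).indicator (measurableSet_Iio (a := T))
  continuous := by
    filter_upwards [hM.ℓ_continuous, hM.h_continuous] with t hℓ hh
    have h1 : Continuous fun z : (closure M.Ω × closure M.Ω) ×
        (EuclideanSpace ℝ (Fin d) × EuclideanSpace ℝ (Fin d)) => M.ℓ t z.1.1 z.2.1 :=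
      hℓ.comp (f := fun z : (closure M.Ω × closure M.Ω) ×
        (EuclideanSpace ℝ (Fin d) × EuclideanSpace ℝ (Fin d)) => (z.1.1, z.2.1)) (by fun_prop)
    have h2 : Continuous fun z : (closure M.Ω × closure M.Ω) ×
        (EuclideanSpace ℝ (Fin d) × EuclideanSpace ℝ (Fin d)) => M.ℓ t z.1.2 z.2.2 :=
      hℓ.comp (f := fun z : (closure M.Ω × closure M.Ω) ×
        (EuclideanSpace ℝ (Fin d) × EuclideanSpace ℝ (Fin d)) => (z.1.2, z.2.2)) (by fun_prop)
    refine (h1.add h2).add ?_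
    split_ifs
    · exact hh
    · exact continuous_const
  convex := by
    filter_upwards [hM.ℓ_convex, hM.h_convex] with t hℓ hh z
    have h1 : ConvexOn ℝ univ (fun q : EuclideanSpace ℝ (Fin d) × EuclideanSpace ℝ (Fin d) =>
        (M.ℓ t z.1 q.1 : ℝ)) :=
      (hℓ z.1).comp_linearMap (LinearMap.fst ℝ _ _)
    have h2 : ConvexOn ℝ univ (fun q : EuclideanSpace ℝ (Fin d) × EuclideanSpace ℝ (Fin d) =>
        (M.ℓ t z.2 q.2 : ℝ)) :=
      (hℓ z.2).comp_linearMap (LinearMap.snd ℝ _ _)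
    have h3 : ConvexOn ℝ univ (fun q : EuclideanSpace ℝ (Fin d) × EuclideanSpace ℝ (Fin d) =>
        ((if t < T then M.h t z.1 z.2 q.1 q.2 else 0 : ℝ≥0) : ℝ)) := by
      split_ifs
      · exact hh z.1 z.2
      · simpa using convexOn_const (0 : ℝ) convex_univ
    exact ((h1.add h2).add h3).congr fun q _ => by simp [pairIntegrand]
  superlinear B := by
    obtain ⟨R, hR0, hR⟩ := hM.ℓ_superlinear B
    refine ⟨R, fun t z q => ?_⟩
    have h1 := hR t z.1 q.1
    have h2 := hR t z.2 q.2
    have h3 : (M.ℓ t z.1 q.1 : ℝ) + M.ℓ t z.2 q.2 ≤ M.pairIntegrand T t z q := by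
      rw [← NNReal.coe_add, NNReal.coe_le_coe]
      exact le_self_add
    have h4 := (M.ℓ t z.1 q.1).coe_nonneg
    have h5 := (M.ℓ t z.2 q.2).coe_nonneg
    rw [Prod.norm_def]
    rcases max_choice ‖q.1‖ ‖q.2‖ with h | h <;> rw [h] <;> linarith

theorem Hypotheses.lintegral_pairIntegrand (hM : M.Hypotheses θ) (T : ℝ≥0) (γ γ' : Traj M.Ω) :
    ∫⁻ t, M.pairIntegrand T t (γ t, γ' t) (vel γ t, vel γ' t) ∂halfLine =
      ∫⁻ t, M.ℓ t (γ t) (vel γ t) ∂halfLine + ∫⁻ t, M.ℓ t (γ' t) (vel γ' t) ∂halfLine +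
        ∫⁻ t in Iio T, M.h t (γ t) (γ' t) (vel γ t) (vel γ' t) ∂halfLine := by
  have h := (hM.aemeasurable_ℓ γ).add (hM.aemeasurable_ℓ γ')
  rw [← lintegral_indicator measurableSet_Iio, ← lintegral_add_left' (hM.aemeasurable_ℓ γ)]
  refine Eq.trans ?_ (lintegral_add_left' h _)
  refine lintegral_congr fun t => ?_
  simp only [pairIntegrand, ENNReal.coe_add, Pi.add_apply, indicator, mem_Iio]
  congr 1
  split_ifs <;> rfl

/-! ### Sublevel sets of the individual cost -/

theorem L_le_iff {γ : Traj M.Ω} {κ : ℝ≥0} : M.L γ ≤ κ ↔ IsAC γ ∧ M.individualCost γ ≤ κ := by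
  rw [L]
  split_ifs with h <;> simp [h]

theorem Hypotheses.equiAC_sublevel (hM : M.Hypotheses θ) (κ : ℝ≥0) :
    EquiAC {γ : Traj M.Ω | M.L γ ≤ κ} := by
  refine ⟨fun γ hγ => (L_le_iff.1 hγ).1, fun ε hε => ?_⟩
  obtain ⟨δ, hδ, h⟩ := hM.coerciveIntegrand_ℓ.exists_setLIntegral_enorm_le κ hε
  exact ⟨δ, hδ, fun γ hγ S _ hSδ =>
    h γ (vel γ) (le_self_add.trans (L_le_iff.1 hγ).2) S hSδ⟩

theorem tendstoUniformlyOn_Iic {Z : Type*} [UniformSpace Z] {γ : C(ℝ≥0, Z)}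
    {l : Filter C(ℝ≥0, Z)} (hl : l ≤ 𝓝 γ) (T : ℝ≥0) :
    TendstoUniformlyOn (fun ω t => ω t) γ l (Iic T) := by
  have h := ContinuousMap.tendsto_iff_forall_isCompact_tendstoUniformlyOn.1 (tendsto_id'.2 hl)
  refine h _ ?_
  rw [← Icc_bot]
  exact isCompact_Icc

/-- Both terms of the individual cost are lower semicontinuous along a sublevel set, on which the
velocities converge weakly and Tonelli's theorem applies. -/
theorem Hypotheses.lowerSemicontinuous_L (hM : M.Hypotheses θ) : LowerSemicontinuous M.L := by
  have := hM.nonempty_closure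
  rw [lowerSemicontinuous_iff_isClosed_preimage]
  intro y
  induction y with
  | top => simp
  | coe κ =>
    refine isClosed_of_closure_subset fun γ hγ => ?_
    have hK := hM.equiAC_sublevel κ
    have hγac : IsAC γ := hK.isAC_of_mem_closure hγ
    have hne := mem_closure_iff_nhdsWithin_neBot.1 hγ
    set l := 𝓝[M.L ⁻¹' Iic (κ : ℝ≥0∞)] γ with hldef
    have hl : l ≤ 𝓝 γ := nhdsWithin_le_nhds
    have hlK : M.L ⁻¹' Iic (κ : ℝ≥0∞) ∈ l := self_mem_nhdsWithin
    have h1 := hM.coerciveIntegrand_ℓ.lintegral_le_liminf γ.continuous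
      (tendstoUniformlyOn_Iic hl) hγac.integrableOn_vel
      (ui := fun ω : Traj M.Ω => vel ω)
      (by filter_upwards [hlK] with ω hω using (hK.1 ω hω).integrableOn_vel)
      (stronglyMeasurable_vel γ).aestronglyMeasurable
      (fun T S hS hST => hK.tendsto_setIntegral_vel hγac hl hlK T hS hST)
    have h2 := (LowerSemicontinuousAt.le_liminf (hM.lowerSemicontinuous_Ψext_τ γ)).trans
      (liminf_le_liminf_of_le hl)
    refine L_le_iff.2 ⟨hγac, ?_⟩
    refine (add_le_add h1 h2).trans ((ENNReal.liminf_add_liminf_le _ _).trans ?_)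
    refine liminf_le_of_frequently_le' (Eventually.frequently ?_)
    filter_upwards [hlK] with ω hω using (L_le_iff.1 hω).2

theorem Hypotheses.compactSpace_closure (hM : M.Hypotheses θ) : CompactSpace (closure M.Ω) :=
  isCompact_iff_compactSpace.1 hM.Ω_bounded.isCompact_closure

/-- By the Arzelà–Ascoli theorem: a sublevel set is closed and equicontinuous, and the curves take
values in a compact set. -/
theorem Hypotheses.isCompact_sublevel (hM : M.Hypotheses θ) (κ : ℝ≥0) :
    IsCompact {γ : Traj M.Ω | M.L γ ≤ κ} := by
  have := hM.compactSpace_closure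
  have hcl : IsClosed {γ : Traj M.Ω | M.L γ ≤ κ} := hM.lowerSemicontinuous_L.isClosed_preimage κ
  rw [← hcl.closure_eq]
  refine ArzelaAscoli.isCompact_closure_of_isClosedEmbedding
    (𝔖 := {K : Set ℝ≥0 | IsCompact K}) (F := fun (γ : Traj M.Ω) (t : ℝ≥0) => γ t)
    (fun K hK => hK) ?_ ?_ ?_
  · have h := ContinuousMap.isUniformEmbedding_toUniformOnFunIsCompact
      (α := ℝ≥0) (β := closure M.Ω)
    have hT2 : T2Space (UniformOnFun ℝ≥0 (closure M.Ω) {K | IsCompact K}) :=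
      UniformOnFun.t2Space_of_covering (sUnion_eq_univ_iff.2 fun t =>
        ⟨{t}, isCompact_singleton, mem_singleton t⟩)
    refine ⟨h.isEmbedding, ?_⟩
    have := (completeSpace_iff_isComplete_range h.isUniformInducing).1 inferInstance
    exact this.isClosed
  · exact fun K _ => (hM.equiAC_sublevel κ).equicontinuous.equicontinuousOn K
  · exact fun K _ t _ => ⟨univ, isCompact_univ, fun _ _ => mem_univ _⟩

/-! ### The cost of a pair of curves -/

theorem toNAG_J (m₀ : ProbabilityMeasure (closure M.Ω)) (γ γ' : Traj M.Ω) :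
    (M.toNAG m₀).J γ γ' = M.L γ + M.L γ' + M.H γ γ' := rfl

theorem L_le_J {m₀ : ProbabilityMeasure (closure M.Ω)} {γ γ' : Traj M.Ω} {c : ℝ≥0∞}
    (h : (M.toNAG m₀).J γ γ' ≤ c) : M.L γ ≤ c ∧ M.L γ' ≤ c :=
  ⟨(le_self_add.trans le_self_add).trans h, (le_add_self.trans le_self_add).trans h⟩

theorem H_of_lt_top {γ γ' : Traj M.Ω} (h : M.L γ < ⊤) (h' : M.L γ' < ⊤) :
    M.H γ γ' = M.pairCost γ γ' := if_pos ⟨h, h'⟩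

theorem L_of_isAC {γ : Traj M.Ω} (h : IsAC γ) : M.L γ = M.individualCost γ := if_pos h

/-- To bound the pair cost it suffices to bound the interaction up to each time strictly before both
exit times; the time `0` covers the case in which one of these is zero. -/
theorem pairCost_le_of_forall {γ γ' : Traj M.Ω} {A c : ℝ≥0∞}
    (h : ∀ T : ℝ≥0, (T = 0 ∨ (T : ℝ≥0∞) < min (M.τ γ) (M.τ γ')) →
      A + ∫⁻ t in Iio T, M.h t (γ t) (γ' t) (vel γ t) (vel γ' t) ∂halfLine ≤ c) :
    A + M.pairCost γ γ' ≤ c := by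
  rw [pairCost]
  set s := min (M.τ γ) (M.τ γ') with hs
  rcases eq_or_ne s 0 with h0 | h0
  · have := h 0 (Or.inl rfl)
    simpa [h0] using le_self_add.trans this
  obtain ⟨v, hv, hvs, hlim⟩ := exists_seq_strictMono_tendsto' (pos_iff_ne_zero.2 h0)
  have hfin : ∀ n, v n ≠ ⊤ := fun n => ((hvs n).2.trans_le le_top).ne
  have hU : {t : ℝ≥0 | (t : ℝ≥0∞) < s} = ⋃ n, Iio (v n).toNNReal := by
    ext t
    simp only [mem_ofPred_eq, mem_iUnion, mem_Iio]
    constructor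
    · intro ht
      obtain ⟨n, hn⟩ := (hlim.eventually (eventually_gt_nhds ht)).exists
      exact ⟨n, by rwa [← ENNReal.coe_lt_coe, ENNReal.coe_toNNReal (hfin n)]⟩
    · rintro ⟨n, hn⟩
      rw [← ENNReal.coe_lt_coe, ENNReal.coe_toNNReal (hfin n)] at hn
      exact hn.trans (hvs n).2
  have hdir : Directed (· ⊆ ·) fun n => Iio (v n).toNNReal :=
    Monotone.directed_le fun m n hmn =>
      Iio_subset_Iio (ENNReal.toNNReal_mono (hfin n) (hv.monotone hmn))
  rw [hU, setLIntegral_iUnion_of_directed _ hdir, ENNReal.add_iSup]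
  refine iSup_le fun n => h _ (Or.inr ?_)
  rw [ENNReal.coe_toNNReal (hfin n)]
  exact (hvs n).2

/-- Lower semicontinuity of the cost of a pair of curves, with the interaction stopped at a fixed
time, along curves of equi-integrable velocities. -/
theorem Hypotheses.lintegral_pairIntegrand_le_liminf (hM : M.Hypotheses θ) {K : Set (Traj M.Ω)}
    (hK : EquiAC K) {γ γ' : Traj M.Ω} (hac : IsAC γ) (hac' : IsAC γ')
    {l : Filter (Traj M.Ω × Traj M.Ω)} (hl1 : map Prod.fst l ≤ 𝓝 γ) (hl2 : map Prod.snd l ≤ 𝓝 γ')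
    (hlK1 : K ∈ map Prod.fst l) (hlK2 : K ∈ map Prod.snd l) (T : ℝ≥0) :
    ∫⁻ t, M.pairIntegrand T t (γ t, γ' t) (vel γ t, vel γ' t) ∂halfLine ≤
      liminf (fun ω : Traj M.Ω × Traj M.Ω => ∫⁻ t, M.pairIntegrand T t (ω.1 t, ω.2 t)
        (vel ω.1 t, vel ω.2 t) ∂halfLine) l := by
  have := hM.nonempty_closure
  have hint : ∀ ω : Traj M.Ω × Traj M.Ω, IsAC ω.1 → IsAC ω.2 → ∀ T,
      IntegrableOn (fun t => (vel ω.1 t, vel ω.2 t)) (Iic T) halfLine :=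
    fun ω h1 h2 T => (h1.integrableOn_vel T).prodMk (h2.integrableOn_vel T)
  have hunif : ∀ T, TendstoUniformlyOn (fun (ω : Traj M.Ω × Traj M.Ω) t => (ω.1 t, ω.2 t))
      (fun t => (γ t, γ' t)) l (Iic T) := by
    intro T
    rw [Metric.tendstoUniformlyOn_iff]
    intro ε hε
    have h1 := Metric.tendstoUniformlyOn_iff.1 (tendstoUniformlyOn_Iic hl1 T) ε hε
    have h2 := Metric.tendstoUniformlyOn_iff.1 (tendstoUniformlyOn_Iic hl2 T) ε hε
    rw [eventually_map] at h1 h2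
    filter_upwards [h1, h2] with ω h1 h2 t ht
    rw [Prod.dist_eq]
    exact max_lt (h1 t ht) (h2 t ht)
  have hweak : ∀ T S, MeasurableSet S → S ⊆ Iic T →
      Tendsto (fun ω : Traj M.Ω × Traj M.Ω => ∫ t in S, (vel ω.1 t, vel ω.2 t) ∂halfLine) l
        (𝓝 (∫ t in S, (vel γ t, vel γ' t) ∂halfLine)) := by
    intro T S hS hST
    have hpair : ∀ ω : Traj M.Ω × Traj M.Ω, IsAC ω.1 → IsAC ω.2 →
        ∫ t in S, (vel ω.1 t, vel ω.2 t) ∂halfLine =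
          (∫ t in S, vel ω.1 t ∂halfLine, ∫ t in S, vel ω.2 t ∂halfLine) :=
      fun ω h1 h2 => integral_pair ((h1.integrableOn_vel T).mono_set hST)
        ((h2.integrableOn_vel T).mono_set hST)
    rw [hpair (γ, γ') hac hac']
    have h1 := tendsto_map'_iff.1 (hK.tendsto_setIntegral_vel hac hl1 hlK1 T hS hST)
    have h2 := tendsto_map'_iff.1 (hK.tendsto_setIntegral_vel hac' hl2 hlK2 T hS hST)
    refine Tendsto.congr' ?_ (h1.prodMk_nhds h2)
    filter_upwards [mem_map.1 hlK1, mem_map.1 hlK2] with ω hω1 hω2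
    exact (hpair ω (hK.1 _ hω1) (hK.1 _ hω2)).symm
  exact (hM.coerciveIntegrand_pairIntegrand T).lintegral_le_liminf
    (z := fun t => (γ t, γ' t)) (γ.continuous.prodMk γ'.continuous) hunif
    (hint (γ, γ') hac hac')
    (ui := fun (ω : Traj M.Ω × Traj M.Ω) t => (vel ω.1 t, vel ω.2 t))
    (by filter_upwards [mem_map.1 hlK1, mem_map.1 hlK2] with ω hω1 hω2
        using hint ω (hK.1 _ hω1) (hK.1 _ hω2))
    ((stronglyMeasurable_vel γ).prodMk (stronglyMeasurable_vel γ')).aestronglyMeasurable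
    hweak

/-- Before the exit times of both curves, the stopped cost is part of the cost of the pair. -/
theorem Hypotheses.lintegral_pairIntegrand_add_le_J (hM : M.Hypotheses θ)
    {m₀ : ProbabilityMeasure (closure M.Ω)} {γ γ' : Traj M.Ω} {κ T : ℝ≥0}
    (hJ : (M.toNAG m₀).J γ γ' ≤ κ) (hT : (T : ℝ≥0∞) ≤ min (M.τ γ) (M.τ γ')) :
    ∫⁻ t, M.pairIntegrand T t (γ t, γ' t) (vel γ t, vel γ' t) ∂halfLine +
      M.Ψext (M.τ γ) + M.Ψext (M.τ γ') ≤ κ := by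
  refine le_trans ?_ hJ
  obtain ⟨h1, h2⟩ := L_le_J hJ
  rw [toNAG_J, H_of_lt_top (lt_of_le_of_lt h1 ENNReal.coe_lt_top)
    (lt_of_le_of_lt h2 ENNReal.coe_lt_top), L_of_isAC (L_le_iff.1 h1).1,
    L_of_isAC (L_le_iff.1 h2).1, hM.lintegral_pairIntegrand, individualCost, individualCost]
  have h3 : ∫⁻ t in Iio T, M.h t (γ t) (γ' t) (vel γ t) (vel γ' t) ∂halfLine ≤
      M.pairCost γ γ' :=
    lintegral_mono_set fun t ht => lt_of_lt_of_le (ENNReal.coe_lt_coe.2 ht) hT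
  refine (add_le_add_left (add_le_add_left (add_le_add_right h3 _) _) _).trans (le_of_eq ?_)
  ring

/-- The interaction is stopped at a fixed time before both exit times, which by lower semicontinuity
of the exit time is also before the exit times of all nearby curves; this time is then increased. -/
theorem Hypotheses.lowerSemicontinuous_J (hM : M.Hypotheses θ)
    (m₀ : ProbabilityMeasure (closure M.Ω)) :
    LowerSemicontinuous fun z : Traj M.Ω × Traj M.Ω => (M.toNAG m₀).J z.1 z.2 := by
  rw [lowerSemicontinuous_iff_isClosed_preimage]
  intro y
  induction y with
  | top => simp
  | coe κ =>
    refine isClosed_of_closure_subset fun z hz => ?_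
    obtain ⟨γ, γ'⟩ := z
    let K : Set (Traj M.Ω) := {γ | M.L γ ≤ κ}
    let K₂ : Set (Traj M.Ω × Traj M.Ω) := {z | (M.toNAG m₀).J z.1 z.2 ≤ κ}
    change (γ, γ') ∈ closure K₂ at hz
    have hK : EquiAC K := hM.equiAC_sublevel κ
    have hsub : K₂ ⊆ K ×ˢ K := fun z hz => mem_prod.2 (L_le_J hz)
    have hmem : γ ∈ K ∧ γ' ∈ K := by
      have hcl : IsClosed K := hM.lowerSemicontinuous_L.isClosed_preimage κ
      have hmem2 : (γ, γ') ∈ K ×ˢ K := closure_minimal hsub (hcl.prod hcl) hz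
      exact mem_prod.1 hmem2
    have hne := mem_closure_iff_nhdsWithin_neBot.1 hz
    let l := 𝓝[K₂] (γ, γ')
    have hl : l ≤ 𝓝 (γ, γ') := nhdsWithin_le_nhds
    have hl1 : map Prod.fst l ≤ 𝓝 γ := (continuous_fst.tendsto (γ, γ')).mono_left hl
    have hl2 : map Prod.snd l ≤ 𝓝 γ' := (continuous_snd.tendsto (γ, γ')).mono_left hl
    have hlK₂ : K₂ ∈ l := self_mem_nhdsWithin
    have hlK1 : K ∈ map Prod.fst l := by
      rw [mem_map]; filter_upwards [hlK₂] with ω hω using (hsub hω).1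
    have hlK2 : K ∈ map Prod.snd l := by
      rw [mem_map]; filter_upwards [hlK₂] with ω hω using (hsub hω).2
    have hac := hK.1 γ hmem.1
    have hac' := hK.1 γ' hmem.2
    have hΨ1 : M.Ψext (M.τ γ) ≤ liminf (fun ω => M.Ψext (M.τ ω.1)) l :=
      (LowerSemicontinuousAt.le_liminf (hM.lowerSemicontinuous_Ψext_τ γ)).trans
        (liminf_le_liminf_of_le hl1)
    have hΨ2 : M.Ψext (M.τ γ') ≤ liminf (fun ω => M.Ψext (M.τ ω.2)) l :=
      (LowerSemicontinuousAt.le_liminf (hM.lowerSemicontinuous_Ψext_τ γ')).trans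
        (liminf_le_liminf_of_le hl2)
    -- the costs with the interaction stopped at a time `T` before both exit times
    have hT : ∀ T : ℝ≥0, (T = 0 ∨ (T : ℝ≥0∞) < min (M.τ γ) (M.τ γ')) →
        (M.individualCost γ + M.individualCost γ') +
          ∫⁻ t in Iio T, M.h t (γ t) (γ' t) (vel γ t) (vel γ' t) ∂halfLine ≤ κ := by
      intro T hT
      have hev : ∀ᶠ ω in l, (T : ℝ≥0∞) ≤ min (M.τ ω.1) (M.τ ω.2) := by
        rcases hT with rfl | hT
        · exact Eventually.of_forall fun ω => by simp
        · obtain ⟨h1, h2⟩ := lt_min_iff.1 hT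
          have e1 : ∀ᶠ ω in map Prod.fst l, (T : ℝ≥0∞) < M.τ ω :=
            Filter.Eventually.filter_mono hl1 (lowerSemicontinuous_τ hM.Ξ_closed γ _ h1)
          have e2 : ∀ᶠ ω in map Prod.snd l, (T : ℝ≥0∞) < M.τ ω :=
            Filter.Eventually.filter_mono hl2 (lowerSemicontinuous_τ hM.Ξ_closed γ' _ h2)
          filter_upwards [eventually_map.1 e1, eventually_map.1 e2] with ω h1 h2
          exact le_min h1.le h2.le
      have hmain := hM.lintegral_pairIntegrand_le_liminf hK hac hac' hl1 hl2 hlK1 hlK2 T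
      calc _ = ∫⁻ t, M.pairIntegrand T t (γ t, γ' t) (vel γ t, vel γ' t) ∂halfLine +
            M.Ψext (M.τ γ) + M.Ψext (M.τ γ') := by
            rw [hM.lintegral_pairIntegrand, individualCost, individualCost]
            ring
        _ ≤ _ := add_le_add (add_le_add hmain hΨ1) hΨ2
        _ ≤ _ := add_le_add_left (ENNReal.liminf_add_liminf_le _ _) _
        _ ≤ _ := ENNReal.liminf_add_liminf_le _ _
        _ ≤ κ := by
            refine liminf_le_of_frequently_le' (Eventually.frequently ?_)
            filter_upwards [hlK₂, hev] with ω hω hTω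
            exact hM.lintegral_pairIntegrand_add_le_J hω hTω
    change (M.toNAG m₀).J γ γ' ≤ κ
    rw [toNAG_J, H_of_lt_top (lt_of_le_of_lt hmem.1 ENNReal.coe_lt_top)
      (lt_of_le_of_lt hmem.2 ENNReal.coe_lt_top), L_of_isAC hac, L_of_isAC hac']
    exact pairCost_le_of_forall hT

theorem isAC_of_L_lt_top {γ : Traj M.Ω} (h : M.L γ < ⊤) : IsAC γ := by
  by_contra hcon
  exact h.ne (if_neg hcon)

/-! ### The assumptions on the associated non-atomic game -/

theorem polishSpace_closure : PolishSpace (closure M.Ω) :=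
  isClosed_closure.polishSpace

theorem polishSpace_traj : PolishSpace (Traj M.Ω) := by
  have : CompleteSpace (closure M.Ω) := isClosed_closure.completeSpace_coe
  have : (uniformity (Traj M.Ω)).IsCountablyGenerated := inferInstance
  exact {}

/-- Where the individual costs are finite, `H` is the difference of the lower semicontinuous
functions `J` and `(γ, γ') ↦ L γ + L γ'`. -/
theorem Hypotheses.measurable_H (hM : M.Hypotheses θ) :
    Measurable fun z : Traj M.Ω × Traj M.Ω => M.H z.1 z.2 := by
  classical
  have hL : Measurable M.L := hM.lowerSemicontinuous_L.measurable
  have hL1 : Measurable fun z : Traj M.Ω × Traj M.Ω => M.L z.1 := hL.comp measurable_fst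
  have hL2 : Measurable fun z : Traj M.Ω × Traj M.Ω => M.L z.2 := hL.comp measurable_snd
  -- `J` does not depend on the initial distribution, so that any one will do
  obtain ⟨x⟩ := hM.nonempty_closure
  let m₀ : ProbabilityMeasure (closure M.Ω) := ⟨Measure.dirac x, inferInstance⟩
  have hJ : Measurable fun z : Traj M.Ω × Traj M.Ω => (M.toNAG m₀).J z.1 z.2 :=
    (hM.lowerSemicontinuous_J m₀).measurable
  have heq : (fun z : Traj M.Ω × Traj M.Ω => M.H z.1 z.2) = fun z =>
      if M.L z.1 < ⊤ ∧ M.L z.2 < ⊤ then (M.toNAG m₀).J z.1 z.2 - (M.L z.1 + M.L z.2) else ⊤ := by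
    funext z
    split_ifs with h
    · rw [toNAG_J, ENNReal.add_sub_cancel_left (ENNReal.add_lt_top.2 h).ne]
    · exact if_neg h
  rw [heq]
  refine Measurable.ite ?_ (hJ.sub (hL1.add hL2)) measurable_const
  exact (measurableSet_lt hL1 measurable_const).inter (measurableSet_lt hL2 measurable_const)

theorem Hypotheses.pairCost_comm (hM : M.Hypotheses θ) (γ γ' : Traj M.Ω) :
    M.pairCost γ γ' = M.pairCost γ' γ := by
  simp only [pairCost, min_comm (M.τ γ) (M.τ γ')]
  exact lintegral_congr fun t => by rw [hM.h_symm]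

theorem Hypotheses.H_comm (hM : M.Hypotheses θ) (γ γ' : Traj M.Ω) : M.H γ γ' = M.H γ' γ := by
  simp only [H, hM.pairCost_comm γ γ', and_comm]

/-- As its growth exponent is at most `θ`, the interaction cost is controlled by the running
cost. -/
theorem Hypotheses.exists_h_le (hM : M.Hypotheses θ) :
    ∃ A B : ℝ≥0, ∀ t x x' p p', M.h t x x' p p' ≤ A + B * (M.ℓ t x p + M.ℓ t x' p') := by
  obtain ⟨C, β, hC, hβ, hβθ, h⟩ := hM.h_upper
  obtain ⟨α, hα, hℓ⟩ := hM.ℓ_lower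
  have hpow : ∀ t x p, ‖p‖ ^ β ≤ 1 + (M.ℓ t x p : ℝ) / α := by
    intro t x p
    have h1 : ‖p‖ ^ β ≤ 1 + ‖p‖ ^ θ := by
      rcases le_total ‖p‖ 1 with hp | hp
      · have := Real.rpow_le_one (norm_nonneg p) hp hβ.le
        have := Real.rpow_nonneg (norm_nonneg p) θ
        linarith
      · have := Real.rpow_le_rpow_of_exponent_le hp hβθ
        linarith
    have h2 : ‖p‖ ^ θ ≤ (M.ℓ t x p : ℝ) / α := by
      rw [le_div_iff₀' hα]; exact hℓ t x p
    linarith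
  lift C to ℝ≥0 using hC.le
  lift α to ℝ≥0 using hα.le
  refine ⟨2 * C, C / α, fun t x x' p p' => ?_⟩
  rw [← NNReal.coe_le_coe]
  push_cast
  refine (h t x x' p p').trans ?_
  calc (C : ℝ) * (‖p‖ ^ β + ‖p'‖ ^ β)
      ≤ C * ((1 + (M.ℓ t x p : ℝ) / α) + (1 + (M.ℓ t x' p' : ℝ) / α)) := by
        gcongr
        · exact hpow t x p
        · exact hpow t x' p'
    _ = _ := by ring

theorem halfLine_setOf_coe_lt_le (s : ℝ≥0∞) : halfLine {t : ℝ≥0 | (t : ℝ≥0∞) < s} ≤ s := by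
  induction s with
  | top => exact le_top
  | coe s =>
    refine le_of_le_of_eq (measure_mono fun t ht => ?_) (halfLine_Iic s)
    exact (ENNReal.coe_lt_coe.1 ht).le

theorem Hypotheses.exists_H_le (hM : M.Hypotheses θ) :
    ∃ C : ℝ≥0, 0 < C ∧ ∀ γ γ' : Traj M.Ω, M.H γ γ' ≤ C * (M.L γ + M.L γ' + 1) := by
  obtain ⟨A, B, hAB⟩ := hM.exists_h_le
  obtain ⟨c₁, c₂, hc⟩ := hM.exists_le_Ψext
  refine ⟨A * c₁ + A * c₂ + B + 1, by positivity, fun γ γ' => ?_⟩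
  have hC0 : ((A * c₁ + A * c₂ + B + 1 : ℝ≥0) : ℝ≥0∞) ≠ 0 := by
    exact_mod_cast (by positivity : (0 : ℝ≥0) < A * c₁ + A * c₂ + B + 1).ne'
  by_cases hfin : M.L γ < ⊤ ∧ M.L γ' < ⊤
  swap
  · have : M.L γ + M.L γ' + 1 = ⊤ := by
      rw [not_and_or, not_lt_top_iff, not_lt_top_iff] at hfin
      rcases hfin with h | h <;> simp [h]
    rw [this, ENNReal.mul_top hC0]
    exact le_top
  rw [H_of_lt_top hfin.1 hfin.2, L_of_isAC (isAC_of_L_lt_top hfin.1),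
    L_of_isAC (isAC_of_L_lt_top hfin.2)]
  set S := {t : ℝ≥0 | (t : ℝ≥0∞) < min (M.τ γ) (M.τ γ')} with hS
  have hτ : halfLine S ≤ c₁ * M.individualCost γ + c₂ :=
    (halfLine_setOf_coe_lt_le _).trans ((min_le_left _ _).trans ((hc _).trans
      (by gcongr; exact le_add_self)))
  have hint : M.pairCost γ γ' ≤
      A * halfLine S + B * (M.individualCost γ + M.individualCost γ') := by
    have hpt : ∀ t, (M.h t (γ t) (γ' t) (vel γ t) (vel γ' t) : ℝ≥0∞) ≤
        A + B * ((M.ℓ t (γ t) (vel γ t) : ℝ≥0∞) + M.ℓ t (γ' t) (vel γ' t)) := fun t => by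
      exact_mod_cast hAB t (γ t) (γ' t) (vel γ t) (vel γ' t)
    refine (lintegral_mono hpt).trans ?_
    rw [lintegral_add_left measurable_const, setLIntegral_const,
      lintegral_const_mul' _ _ ENNReal.coe_ne_top,
      lintegral_add_left' (hM.aemeasurable_ℓ γ).restrict]
    gcongr
    · exact (setLIntegral_le_lintegral _ _).trans le_self_add
    · exact (setLIntegral_le_lintegral _ _).trans le_self_add
  refine hint.trans ?_
  calc A * halfLine S + B * (M.individualCost γ + M.individualCost γ')
      ≤ A * (c₁ * M.individualCost γ + c₂) + B * (M.individualCost γ + M.individualCost γ') := by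
        gcongr
    _ = A * c₁ * M.individualCost γ + A * c₂ * 1 +
          B * (M.individualCost γ + M.individualCost γ') := by ring
    _ ≤ A * c₁ * (M.individualCost γ + M.individualCost γ' + 1) +
          A * c₂ * (M.individualCost γ + M.individualCost γ' + 1) +
          B * (M.individualCost γ + M.individualCost γ' + 1) +
          1 * (M.individualCost γ + M.individualCost γ' + 1) := by
        refine le_trans (add_le_add (add_le_add ?_ ?_) ?_) le_self_add
        · gcongr; exact le_self_add.trans le_self_add
        · gcongr; exact le_add_self
        · exact mul_le_mul' le_rfl le_self_add
    _ = _ := by push_cast; ring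

theorem Hypotheses.assumptions_toNAG (hM : M.Hypotheses θ)
    (m₀ : ProbabilityMeasure (closure M.Ω)) : (M.toNAG m₀).Assumptions where
  polish := ⟨polishSpace_traj, polishSpace_closure⟩
  continuous_π := continuous_e₀
  lsc_L_measurable_H := by
    refine ⟨hM.lowerSemicontinuous_L, ?_⟩
    rw [← BorelSpace.measurable_eq (α := Traj M.Ω × Traj M.Ω),
      ← BorelSpace.measurable_eq (α := ℝ≥0∞)]
    exact hM.measurable_H
  symm_H := hM.H_comm
  lsc_J := hM.lowerSemicontinuous_J m₀
  domain := by
    obtain ⟨κ, hκ, h⟩ := hM.accessible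
    refine ⟨κ, hκ, fun y => ?_⟩
    obtain ⟨γ, hγ, hy, hle⟩ := h y
    exact ⟨γ, hy, L_le_iff.2 ⟨hγ, hle⟩⟩
  compact κ _ := hM.isCompact_sublevel κ
  H_le := hM.exists_H_le

/-! ### Equilibria -/

/-- The bound holds for the lower integral of `F · Q` as well, so that no measurability of `F · Q`
is needed to deduce the integrability of `L` at an equilibrium. -/
theorem L_le_F (γ : Traj M.Ω) (Q : ProbabilityMeasure (Traj M.Ω)) : M.L γ ≤ M.F γ Q := by
  rw [F]
  split_ifs with h
  · rw [L_of_isAC h.1]; exact le_self_add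
  · exact le_top

/-- If the individual cost is `Q`-integrable, then the costs of both games agree on all curves: the
bound of `H` by `L` makes the integrability clause in the definition of `F` hold automatically. -/
theorem Hypotheses.F_eq_toNAG_F (hM : M.Hypotheses θ) (m₀ : ProbabilityMeasure (closure M.Ω))
    {Q : ProbabilityMeasure (Traj M.Ω)} (hQ : ∫⁻ γ, M.L γ ∂(Q : Measure (Traj M.Ω)) < ⊤)
    (γ : Traj M.Ω) : M.F γ Q = (M.toNAG m₀).F γ Q := by
  change M.F γ Q = M.L γ + ∫⁻ γ', M.H γ γ' ∂(Q : Measure (Traj M.Ω))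
  by_cases hγ : M.L γ < ⊤
  swap
  · rw [not_lt_top_iff] at hγ
    have h := L_le_F γ Q
    rw [hγ, top_le_iff] at h
    rw [h, hγ, top_add]
  have hL : Measurable M.L := hM.lowerSemicontinuous_L.measurable
  have hae : ∀ᵐ γ' ∂(Q : Measure (Traj M.Ω)), M.L γ' < ⊤ := ae_lt_top hL hQ.ne
  have hH : (fun γ' => M.H γ γ') =ᵐ[(Q : Measure (Traj M.Ω))] fun γ' => M.pairCost γ γ' := by
    filter_upwards [hae] with γ' h'
    exact H_of_lt_top hγ h'
  have hHm : Measurable fun γ' => M.H γ γ' :=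
    hM.measurable_H.of_uncurry_left
  have hfin : ∫⁻ γ', M.H γ γ' ∂(Q : Measure (Traj M.Ω)) < ⊤ := by
    obtain ⟨C, -, hC⟩ := hM.exists_H_le
    have hle : ∫⁻ γ', M.H γ γ' ∂(Q : Measure (Traj M.Ω)) ≤
        C * (M.L γ + ∫⁻ γ', M.L γ' ∂(Q : Measure (Traj M.Ω)) + 1) := by
      refine (lintegral_mono (hC γ)).trans (le_of_eq ?_)
      rw [lintegral_const_mul _ ((hL.const_add _).add_const _),
        lintegral_add_left (hL.const_add _), lintegral_add_left measurable_const]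
      simp
    refine hle.trans_lt (ENNReal.mul_lt_top ENNReal.coe_lt_top ?_)
    exact ENNReal.add_lt_top.2 ⟨ENNReal.add_lt_top.2 ⟨hγ, hQ⟩, ENNReal.one_lt_top⟩
  rw [lintegral_congr_ae hH] at hfin ⊢
  rw [F, if_pos ⟨isAC_of_L_lt_top hγ, hae.mono fun γ' h => isAC_of_L_lt_top h,
    hHm.aemeasurable.congr hH, hfin⟩, L_of_isAC (isAC_of_L_lt_top hγ)]

/-- The costs only have to be compared when the individual cost is `Q`-integrable, which the finite
total cost of either notion of equilibrium guarantees because `L` is below both costs. -/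
theorem Hypotheses.isEquilibrium_iff (hM : M.Hypotheses θ)
    (m₀ : ProbabilityMeasure (closure M.Ω)) (Q : ProbabilityMeasure (Traj M.Ω)) :
    M.IsEquilibrium m₀ Q ↔ (M.toNAG m₀).IsEquilibrium Q := by
  have key : ∫⁻ γ, M.L γ ∂(Q : Measure (Traj M.Ω)) < ⊤ →
      (M.IsEquilibrium m₀ Q ↔ (M.toNAG m₀).IsEquilibrium Q) := by
    intro hQ
    have hF := hM.F_eq_toNAG_F m₀ hQ
    have hopt : ∀ γ, M.F γ Q = (⨅ (ω : Traj M.Ω) (_ : ω 0 = γ 0), M.F ω Q) ↔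
        (M.toNAG m₀).Solves γ ((M.toNAG m₀).π γ) Q := by
      intro γ
      constructor
      · intro h
        refine ⟨rfl, fun ω hω => ?_⟩
        rw [← hF, ← hF, h]
        exact iInf₂_le ω hω
      · intro h
        refine le_antisymm (le_iInf₂ fun ω hω => ?_) ?_
        · rw [hF, hF]
          exact h.2 ω hω
        · exact iInf₂_le (f := fun (ω : Traj M.Ω) (_ : ω 0 = γ 0) => M.F ω Q) γ rfl
    constructor
    · intro h
      refine ⟨h.marginal, ?_, h.optimal.mono fun γ hγ => (hopt γ).1 hγ⟩
      simpa only [hF] using h.finite_cost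
    · intro h
      refine ⟨h.marginal, ?_, h.optimal.mono fun γ hγ => (hopt γ).2 hγ⟩
      simpa only [hF] using h.finite_cost
  constructor
  · intro h
    exact (key ((lintegral_mono fun γ => L_le_F γ Q).trans_lt h.finite_cost)).1 h
  · intro h
    refine (key ((lintegral_mono fun γ => ?_).trans_lt h.finite_cost)).2 h
    exact le_self_add

end CrowdMFG

theorem mainTheorem5 {d : ℕ} (hd : 0 < d) (M : CrowdMFG d) (θ : ℝ) (hM : M.Hypotheses θ)
    (m₀ : ProbabilityMeasure (closure M.Ω)) :
    (M.toNAG m₀).Assumptions ∧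
    LowerSemicontinuous M.τ ∧
    ∀ Q : ProbabilityMeasure (Traj M.Ω),
      M.IsEquilibrium m₀ Q ↔ (M.toNAG m₀).IsEquilibrium Q :=
  ⟨hM.assumptions_toNAG m₀, CrowdMFG.lowerSemicontinuous_τ hM.Ξ_closed, hM.isEquilibrium_iff m₀⟩
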